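/- For every $n$ let $U=U^{(n)}$ be a random matrix distributed according to the Haar probability measure on the unitary group $\mathbb U(n)$ (for all $n$), or on the orthogonal group $\mathbb O(n)$ (for all $n$). Say that two sequences $(A_n)$, $(B_n)$ of random vectors in $\mathbb R^K$ have the same limiting distribution if $\mathbb E f(A_n)-\mathbb E f(B_n)\to 0$ for every bounded continuous $f:\mathbb R^K\to\mathbb R$, and, for every probability measure $\nu$ on $\mathbb R^K$, $A_n$ converges in distribution to $\nu$ if and only if $B_n$ does. (1) Let $(R_i)_{i\ge1}$ and $(C_j)_{j\ge1}$ be two independent sequences of real random variables, each i.i.d. (the two common laws may differ), centered, with variance $1$ and finite third absolute moment, and let $(X_i)_{i\ge1}$ and $(Y_j)_{j\ge1}$ be two independent sequences of i.i.d. standard Gaussian variables; for every $n$, $U^{(n)}$ is independent of $((R_i),(C_j))$ and independent of $((X_i),(Y_j))$. Then $$A_n=\sum_{i,j=1}^n |U_{ij}|^2R_iC_j\qquad\text{and}\qquad B_n=\sum_{i,j=1}^n |U_{ij}|^2X_iY_j$$ have the same limiting distribution. (2) Let $(R_i)_{i\ge1}$ and $(C_j)_{j\ge1}$ be two independent sequences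 of independent random variables uniformly distributed on $[0,1]$, and let $(\beta_i)_{i\ge1}$ and $(\gamma_j)_{j\ge1}$ be two independent sequences of independent Brownian bridges on $[0,1]$ (centered Gaussian processes with continuous paths and covariance $s\wedge s'-ss'$); for every $n$, $U^{(n)}$ is independent of $((R_i),(C_j))$ and independent of $((\beta_i),(\gamma_j))$. For $s,t\in[0,1]$ set $$\mathcal Z^{(n)}(s,t)=\sum_{i,j=1}^n |U_{ij}|^2\left(\mathbf 1_{R_i\le s}-s\right)\left(\mathbf 1_{C_j\le t}-t\right),\qquad G_n(s,t)=\sum_{i,j=1}^n |U_{ij}|^2\beta_i(s)\gamma_j(t).$$ Then $\mathcal Z^{(n)}$ and $G_n$ have the same finite-dimensional limiting distributions: for all $K$ and all $(s_1,t_1),\dots,(s_K,t_K)\in[0,1]^2$, the random vectors $(\mathcal Z^{(n)}(s_l,t_l))_{l\le K}$ and $(G_n(s_l,t_l))_{l\le K}$ have the same limiting distribution. -/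

import Mathlib

open MeasureTheory ProbabilityTheory Filter
open scoped Topology BoundedContinuousFunction

noncomputable section

namespace RandomTruncation

/-- The unitary (or orthogonal) group carries its Borel σ-algebra. -/
instance unitaryGroupMeasurableSpace {𝕜 : Type*} [RCLike 𝕜] (n : ℕ) :
    MeasurableSpace (Matrix.unitaryGroup (Fin n) 𝕜) :=
  borel _

instance unitaryGroupBorelSpace {𝕜 : Type*} [RCLike 𝕜] (n : ℕ) :
    BorelSpace (Matrix.unitaryGroup (Fin n) 𝕜) :=
  ⟨rfl⟩

/-- `U` is a Haar distributed random matrix of size `n`. Over `𝕜 = ℂ` the group is the unitary group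
`𝕌(n)`, over `𝕜 = ℝ` it is the orthogonal group `𝕆(n)`. -/
structure IsHaarDistributed {𝕜 Ω : Type*} [RCLike 𝕜] [MeasurableSpace Ω] {n : ℕ}
    (U : Ω → Matrix.unitaryGroup (Fin n) 𝕜) (P : Measure Ω) : Prop where
  measurable : Measurable U
  isHaarMeasure : (P.map U).IsHaarMeasure

/-- `(x i)` and `(y j)` are two independent sequences of independent random elements of `E`, and
the pair of sequences is independent of each of the random matrices `U n`. -/
structure IndependentInputs {𝕜 Ω E : Type*} [RCLike 𝕜] [MeasurableSpace Ω] [MeasurableSpace E]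
    (U : (n : ℕ) → Ω → Matrix.unitaryGroup (Fin n) 𝕜) (x y : ℕ → Ω → E) (P : Measure Ω) :
    Prop where
  measurable_left : ∀ i, Measurable (x i)
  measurable_right : ∀ j, Measurable (y j)
  iIndepFun_left : iIndepFun x P
  iIndepFun_right : iIndepFun y P
  indepFun_left_right : IndepFun (fun ω i => x i ω) (fun ω j => y j ω) P
  indepFun_matrix : ∀ n, IndepFun (U n) (fun ω => ((fun i => x i ω), (fun j => y j ω))) P

/-- Identically distributed, centered, of variance `1`, with finite third absolute moment. -/
structure IsStandardizedSeq {Ω : Type*} [MeasurableSpace Ω] (x : ℕ → Ω → ℝ) (P : Measure Ω) :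
    Prop where
  identDistrib : ∀ i, IdentDistrib (x i) (x 0) P P
  integral_eq_zero : ∀ i, ∫ ω, x i ω ∂P = 0
  variance_eq_one : ∀ i, Var[x i; P] = 1
  memLp_three : ∀ i, MemLp (x i) 3 P

/-- Brownian bridge on `[0,1]`: a centered Gaussian process with (almost surely) continuous paths
and covariance `min s s' - s s'`. -/
structure IsBrownianBridge {Ω : Type*} [MeasurableSpace Ω] (b : Ω → unitInterval → ℝ)
    (P : Measure Ω) : Prop where
  isGaussianProcess : IsGaussianProcess (fun s ω => b ω s) P
  centered : ∀ s, ∫ ω, b ω s ∂P = 0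
  covariance : ∀ s s' : unitInterval,
    ∫ ω, b ω s * b ω s' ∂P = min (s : ℝ) (s' : ℝ) - (s : ℝ) * (s' : ℝ)
  continuous_paths : ∀ᵐ ω ∂P, Continuous (b ω)

/-- `∑_{i,j} |U_{ij}|² x_i y_j`. -/
def bilin {𝕜 : Type*} [RCLike 𝕜] {n : ℕ} (U : Matrix.unitaryGroup (Fin n) 𝕜) (x y : ℕ → ℝ) : ℝ :=
  ∑ i : Fin n, ∑ j : Fin n, ‖(U : Matrix (Fin n) (Fin n) 𝕜) i j‖ ^ 2 * x i * y j

/-- `1_{r ≤ s} - s`. -/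
def centeredIndicator (s : unitInterval) (r : ℝ) : ℝ :=
  (Set.Iic (s : ℝ)).indicator 1 r - (s : ℝ)

/-- The process `𝒵⁽ⁿ⁾(s,t) = ∑_{i,j} |U_{ij}|² (1_{R_i ≤ s} - s) (1_{C_j ≤ t} - t)`. -/
def processZ {𝕜 : Type*} [RCLike 𝕜] {n : ℕ} (U : Matrix.unitaryGroup (Fin n) 𝕜) (r c : ℕ → ℝ)
    (s t : unitInterval) : ℝ :=
  bilin U (fun i => centeredIndicator s (r i)) (fun j => centeredIndicator t (c j))

/-- The process `Gₙ(s,t) = ∑_{i,j} |U_{ij}|² β_i(s) γ_j(t)`. -/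
def processG {𝕜 : Type*} [RCLike 𝕜] {n : ℕ} (U : Matrix.unitaryGroup (Fin n) 𝕜)
    (β γ : ℕ → unitInterval → ℝ) (s t : unitInterval) : ℝ :=
  bilin U (fun i => β i s) (fun j => γ j t)

/-- The sequences `A` and `B` have the same limiting distribution: their laws are asymptotically
equal for the weak topology, and one converges in distribution to a law `ν` if and only if the
other one does. -/
structure SameLimitingDistribution {Ω E : Type*} [MeasurableSpace Ω] [TopologicalSpace E]
    [MeasurableSpace E] [OpensMeasurableSpace E] (A B : ℕ → Ω → E) (P : Measure Ω)
    [IsProbabilityMeasure P] : Prop where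
  tendsto_sub : ∀ f : E →ᵇ ℝ,
    Tendsto (fun n => (∫ ω, f (A n ω) ∂P) - ∫ ω, f (B n ω) ∂P) atTop (𝓝 0)
  tendsto_iff : ∀ (ν : Measure E) [IsProbabilityMeasure ν],
    TendstoInDistribution A atTop id (fun _ => P) ν ↔
      TendstoInDistribution B atTop id (fun _ => P) ν

end RandomTruncation

end

/-! Both sequences have coordinates `∑ i j, M i j * x i l * y j l`, where `M i j = ‖U i j‖ ^ 2` has
row and column sums `1`, and the two choices of inputs agree in mean and covariance. In (1) the
single variance is `1`; in (2) a centered indicator of a uniform variable has exactly the covariance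
of the Brownian bridge. The proof is a Lindeberg replacement at the level of characteristic
functions.

Freeze `U` and the `y j`. The form is then linear in the independent vectors `x i`, its
characteristic function is a product, and matching two moments leaves an error of order `∑ i, |∑ j,
M i j * y j l| ^ 3` (`norm_integral_exp_linear_sub_le`). Rosenthal's inequality bounds its mean by a
constant times `rowCubeSum M`, the sum of the `(∑ j, M i j ^ 2) ^ (3/2)`. The `y j` are then
replaced in the same way, with the columns of `M` (`norm_integral_exp_phase_sub_le`).

The Haar measure enters only through left invariance under a rotation by 45 degrees mixing two rows.
It yields `∑ E‖U i j‖ ^ 4 ≤ 3` and `n * ∑ E‖U i j‖ ^ 6 ≤ 15`, over the real and the complex field at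
once. By Cauchy–Schwarz and the row sums, `E (rowCubeSum M)` is then `O(n ^ (-1/2))`, and likewise
for columns.

The fourth moment bound also makes second moments bounded, hence both sequences tight. Neither need
converge, so the comparison of characteristic functions is turned into one of laws by extracting
limits along ultrafilters (`sameLimitingDistribution_of_charFunDual`). -/

noncomputable section

namespace RandomTruncation

/-! ### Moments of the entries of a Haar matrix -/

section Haar

variable {𝕜 m : Type*} [RCLike 𝕜] [Fintype m] [DecidableEq m]

/-- The matrix acting on the coordinates `i`, `k` by `(a, b) ↦ ((a + b)/√2, (a - b)/√2)`. -/
def rotationMatrix (𝕜 : Type*) [RCLike 𝕜] {m : Type*} [DecidableEq m] (i k : m) : Matrix m m 𝕜 :=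
  fun a b =>
    if a = i then (if b = i ∨ b = k then ((√2⁻¹ : ℝ) : 𝕜) else 0)
    else if a = k then
      (if b = i then ((√2⁻¹ : ℝ) : 𝕜) else if b = k then -((√2⁻¹ : ℝ) : 𝕜) else 0)
    else if a = b then 1 else 0

lemma rotationMatrix_star {m : Type*} [DecidableEq m] (i k : m) :
    star (rotationMatrix 𝕜 i k) = rotationMatrix 𝕜 i k := by
  ext a b
  simp only [Matrix.star_apply, rotationMatrix]
  split_ifs <;> first | grind | simp [RCLike.star_def]

lemma sqrt_two_inv_mul_self : (((√2⁻¹ : ℝ) : 𝕜)) * ((√2⁻¹ : ℝ) : 𝕜) = 2⁻¹ := by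
  rw [← RCLike.ofReal_mul, Real.mul_self_sqrt (by norm_num)]
  push_cast
  rfl

lemma rotationMatrix_mulVec {i k : m} (hik : i ≠ k) (v : m → 𝕜) (a : m) :
    (rotationMatrix 𝕜 i k).mulVec v a =
      if a = i then ((√2⁻¹ : ℝ) : 𝕜) * (v i + v k)
      else if a = k then ((√2⁻¹ : ℝ) : 𝕜) * (v i - v k) else v a := by
  simp only [Matrix.mulVec, dotProduct, rotationMatrix]
  split_ifs with h1 h2
  · have : ∀ b, (if b = i ∨ b = k then ((√2⁻¹ : ℝ) : 𝕜) else 0) * v b =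
        (if b = i then ((√2⁻¹ : ℝ) : 𝕜) * v b else 0) +
          (if b = k then ((√2⁻¹ : ℝ) : 𝕜) * v b else 0) := by
      intro b; grind
    simp only [this, Finset.sum_add_distrib, Finset.sum_ite_eq', Finset.mem_univ, if_true]
    ring
  · have : ∀ b, (if b = i then ((√2⁻¹ : ℝ) : 𝕜)
          else if b = k then -((√2⁻¹ : ℝ) : 𝕜) else 0) * v b =
        (if b = i then ((√2⁻¹ : ℝ) : 𝕜) * v b else 0) -
          (if b = k then ((√2⁻¹ : ℝ) : 𝕜) * v b else 0) := by
      intro b; grind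
    simp only [this, Finset.sum_sub_distrib, Finset.sum_ite_eq', Finset.mem_univ, if_true]
    ring
  · simp

lemma rotationMatrix_mul_self {i k : m} (hik : i ≠ k) :
    rotationMatrix 𝕜 i k * rotationMatrix 𝕜 i k = 1 := by
  apply Matrix.toLin'.injective
  apply LinearMap.ext
  intro v
  have hs := sqrt_two_inv_mul_self (𝕜 := 𝕜)
  ext a
  rw [Matrix.toLin'_apply, Matrix.toLin'_apply, ← Matrix.mulVec_mulVec, rotationMatrix_mulVec hik]
  simp only [rotationMatrix_mulVec hik, Matrix.one_mulVec, if_true, hik.symm, if_false]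
  split_ifs with h1 h2
  · subst h1; linear_combination 2 * v a * hs
  · subst h2; linear_combination 2 * v a * hs
  · rfl

/-- `rotationMatrix` as an element of the unitary group. -/
def rotation (𝕜 : Type*) [RCLike 𝕜] {m : Type*} [Fintype m] [DecidableEq m] {i k : m}
    (hik : i ≠ k) : Matrix.unitaryGroup m 𝕜 :=
  ⟨rotationMatrix 𝕜 i k, by
    rw [Matrix.mem_unitaryGroup_iff, rotationMatrix_star, rotationMatrix_mul_self hik]⟩

lemma rotation_mul_apply {i k : m} (hik : i ≠ k) (u : Matrix.unitaryGroup m 𝕜) (a j : m) :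
    ((rotation 𝕜 hik * u : Matrix.unitaryGroup m 𝕜) : Matrix m m 𝕜) a j =
      if a = i then ((√2⁻¹ : ℝ) : 𝕜) * (u.1 i j + u.1 k j)
      else if a = k then ((√2⁻¹ : ℝ) : 𝕜) * (u.1 i j - u.1 k j) else u.1 a j := by
  have := rotationMatrix_mulVec hik (fun b => u.1 b j) a
  rw [← this]
  rfl

lemma sum_norm_sq_col (u : Matrix.unitaryGroup m 𝕜) (j : m) : ∑ i, ‖u.1 i j‖ ^ 2 = 1 := by
  have h := congr_fun (congr_fun (Matrix.mem_unitaryGroup_iff'.1 u.2) j) j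
  simp only [Matrix.mul_apply, Matrix.star_apply, Matrix.one_apply_eq, RCLike.star_def,
    RCLike.conj_mul] at h
  exact_mod_cast h

lemma sum_norm_sq_row (u : Matrix.unitaryGroup m 𝕜) (i : m) : ∑ j, ‖u.1 i j‖ ^ 2 = 1 := by
  have h := congr_fun (congr_fun (Matrix.mem_unitaryGroup_iff.1 u.2) i) i
  simp only [Matrix.mul_apply, Matrix.star_apply, Matrix.one_apply_eq, RCLike.star_def,
    RCLike.mul_conj] at h
  exact_mod_cast h

lemma norm_entry_le_one (u : Matrix.unitaryGroup m 𝕜) (i j : m) : ‖u.1 i j‖ ≤ 1 := by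
  have h : ‖u.1 i j‖ ^ 2 ≤ 1 := by
    rw [← sum_norm_sq_row u i]
    exact Finset.single_le_sum (f := fun j => ‖u.1 i j‖ ^ 2) (fun _ _ => sq_nonneg _)
      (Finset.mem_univ j)
  exact (sq_le_one_iff₀ (norm_nonneg _)).1 h

/-- The cross term `q = 2 Re (a * conj b)` enters the two squares with opposite signs. In the sums
of powers used below only `q ^ 2` survives, and that is what the bound controls. -/
lemma norm_rotated_sq_add (a b : 𝕜) : ∃ q : ℝ, q ^ 2 ≤ 4 * (‖a‖ ^ 2 * ‖b‖ ^ 2) ∧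
    ‖((√2⁻¹ : ℝ) : 𝕜) * (a + b)‖ ^ 2 = (‖a‖ ^ 2 + ‖b‖ ^ 2 + q) / 2 ∧
    ‖((√2⁻¹ : ℝ) : 𝕜) * (a - b)‖ ^ 2 = (‖a‖ ^ 2 + ‖b‖ ^ 2 - q) / 2 := by
  have hs : ‖((√2⁻¹ : ℝ) : 𝕜)‖ ^ 2 = 2⁻¹ := by
    rw [RCLike.norm_ofReal, sq_abs, Real.sq_sqrt (by norm_num)]
  refine ⟨2 * RCLike.re (a * (starRingEnd 𝕜) b), ?_, ?_, ?_⟩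
  · have h := RCLike.abs_re_le_norm (a * (starRingEnd 𝕜) b)
    rw [norm_mul, RCLike.norm_conj] at h
    have h2 := pow_le_pow_left₀ (abs_nonneg _) h 2
    rw [sq_abs] at h2
    nlinarith
  · rw [norm_mul, mul_pow, hs, ← RCLike.normSq_eq_def', ← RCLike.normSq_eq_def',
      ← RCLike.normSq_eq_def', RCLike.normSq_add]
    ring
  · rw [norm_mul, mul_pow, hs, ← RCLike.normSq_eq_def', ← RCLike.normSq_eq_def',
      ← RCLike.normSq_eq_def', RCLike.normSq_sub]
    ring

lemma norm_rotated_fourth_le (a b : 𝕜) :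
    (‖((√2⁻¹ : ℝ) : 𝕜) * (a + b)‖ ^ 2) ^ 2 + (‖((√2⁻¹ : ℝ) : 𝕜) * (a - b)‖ ^ 2) ^ 2 ≤
      ((‖a‖ ^ 2) ^ 2 + (‖b‖ ^ 2) ^ 2) / 2 + 3 * (‖a‖ ^ 2 * ‖b‖ ^ 2) := by
  obtain ⟨q, hq, h1, h2⟩ := norm_rotated_sq_add a b
  rw [h1, h2]
  nlinarith

lemma norm_rotated_sixth_le (a b : 𝕜) :
    (‖((√2⁻¹ : ℝ) : 𝕜) * (a + b)‖ ^ 2) ^ 3 + (‖((√2⁻¹ : ℝ) : 𝕜) * (a - b)‖ ^ 2) ^ 3 ≤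
      ((‖a‖ ^ 2) ^ 3 + (‖b‖ ^ 2) ^ 3) / 4 +
        15 / 4 * ((‖a‖ ^ 2) ^ 2 * ‖b‖ ^ 2 + (‖b‖ ^ 2) ^ 2 * ‖a‖ ^ 2) := by
  obtain ⟨q, hq, h1, h2⟩ := norm_rotated_sq_add a b
  rw [h1, h2]
  have := mul_le_mul_of_nonneg_left hq (by positivity : 0 ≤ ‖a‖ ^ 2 + ‖b‖ ^ 2)
  nlinarith

variable {n : ℕ} {μ : Measure (Matrix.unitaryGroup (Fin n) 𝕜)} [IsProbabilityMeasure μ]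

lemma continuous_norm_entry (i j : Fin n) :
    Continuous fun u : Matrix.unitaryGroup (Fin n) 𝕜 => ‖u.1 i j‖ :=
  (continuous_subtype_val.matrix_elem i j).norm

lemma integrable_entry_monomial (i k j l : Fin n) (a b : ℕ) :
    Integrable (fun u : Matrix.unitaryGroup (Fin n) 𝕜 =>
      (‖u.1 i j‖ ^ 2) ^ a * (‖u.1 k l‖ ^ 2) ^ b) μ := by
  refine Integrable.of_bound (C := 1) ?_ (ae_of_all _ fun u => ?_)
  · have h1 := continuous_norm_entry (𝕜 := 𝕜) i j
    have h2 := continuous_norm_entry (𝕜 := 𝕜) k l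
    exact Continuous.aestronglyMeasurable (by fun_prop)
  · rw [Real.norm_of_nonneg (by positivity)]
    have h1 := norm_entry_le_one u i j
    have h2 := norm_entry_le_one u k l
    exact mul_le_one₀ (pow_le_one₀ (by positivity) (pow_le_one₀ (norm_nonneg _) h1))
      (by positivity) (pow_le_one₀ (by positivity) (pow_le_one₀ (norm_nonneg _) h2))

lemma integrable_entry_pow (i j : Fin n) (a : ℕ) :
    Integrable (fun u : Matrix.unitaryGroup (Fin n) 𝕜 => (‖u.1 i j‖ ^ 2) ^ a) μ := by
  simpa using integrable_entry_monomial (μ := μ) i i j j a 0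

variable [μ.IsMulLeftInvariant]

/-- Left invariance of `μ` under `rotation`, tested on a power of two entries of a column. -/
lemma integral_rotated_pow {i k : Fin n} (hik : i ≠ k) (j : Fin n) (a : ℕ) :
    ∫ u : Matrix.unitaryGroup (Fin n) 𝕜, (‖u.1 i j‖ ^ 2) ^ a ∂μ +
        ∫ u : Matrix.unitaryGroup (Fin n) 𝕜, (‖u.1 k j‖ ^ 2) ^ a ∂μ =
      ∫ u : Matrix.unitaryGroup (Fin n) 𝕜,
        ((‖((√2⁻¹ : ℝ) : 𝕜) * (u.1 i j + u.1 k j)‖ ^ 2) ^ a +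
          (‖((√2⁻¹ : ℝ) : 𝕜) * (u.1 i j - u.1 k j)‖ ^ 2) ^ a) ∂μ := by
  rw [← integral_add (integrable_entry_pow i j a) (integrable_entry_pow k j a),
    ← integral_mul_left_eq_self _ (rotation 𝕜 hik)]
  simp only [rotation_mul_apply, if_true, if_neg hik.symm]

/-- By invariance the left side equals its rotated version, which is at most half the left side plus
three mixed moments; absorbing the half gives `6`. The case `i = k` is included so that the sum can
run over all pairs. -/
lemma integral_entry_fourth_add_le (i k j : Fin n) :
    ∫ u : Matrix.unitaryGroup (Fin n) 𝕜, (‖u.1 i j‖ ^ 2) ^ 2 ∂μ +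
        ∫ u : Matrix.unitaryGroup (Fin n) 𝕜, (‖u.1 k j‖ ^ 2) ^ 2 ∂μ ≤
      6 * ∫ u : Matrix.unitaryGroup (Fin n) 𝕜, (‖u.1 i j‖ ^ 2 * ‖u.1 k j‖ ^ 2) ∂μ := by
  rcases eq_or_ne i k with rfl | hik
  · simp only [← sq]
    have : 0 ≤ ∫ u : Matrix.unitaryGroup (Fin n) 𝕜, (‖u.1 i j‖ ^ 2) ^ 2 ∂μ :=
      integral_nonneg fun u => by positivity
    linarith
  · have hi := integrable_entry_pow (μ := μ) i j 2
    have hk := integrable_entry_pow (μ := μ) k j 2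
    have hm := integrable_entry_monomial (μ := μ) i k j j 1 1
    simp only [pow_one] at hm
    have h := integral_rotated_pow (μ := μ) hik j 2
    have h2 := integral_mono_of_nonneg (μ := μ) (ae_of_all _ fun u => by positivity)
      (((hi.fun_add hk).div_const 2).fun_add (hm.const_mul 3))
      (ae_of_all _ fun u => norm_rotated_fourth_le (u.1 i j) (u.1 k j))
    rw [← h] at h2
    rw [integral_add ((hi.fun_add hk).div_const 2) (hm.const_mul 3)] at h2
    rw [integral_div, integral_add hi hk, integral_const_mul] at h2
    linarith

/-- The same absorption, now of a quarter: `(15 / 4) / (3 / 4) = 5`. -/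
lemma integral_entry_sixth_add_le (i k j : Fin n) :
    ∫ u : Matrix.unitaryGroup (Fin n) 𝕜, (‖u.1 i j‖ ^ 2) ^ 3 ∂μ +
        ∫ u : Matrix.unitaryGroup (Fin n) 𝕜, (‖u.1 k j‖ ^ 2) ^ 3 ∂μ ≤
      5 * (∫ u : Matrix.unitaryGroup (Fin n) 𝕜, ((‖u.1 i j‖ ^ 2) ^ 2 * ‖u.1 k j‖ ^ 2) ∂μ +
        ∫ u : Matrix.unitaryGroup (Fin n) 𝕜, ((‖u.1 k j‖ ^ 2) ^ 2 * ‖u.1 i j‖ ^ 2) ∂μ) := by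
  rcases eq_or_ne i k with rfl | hik
  · simp only [← pow_succ]
    have : 0 ≤ ∫ u : Matrix.unitaryGroup (Fin n) 𝕜, (‖u.1 i j‖ ^ 2) ^ 3 ∂μ :=
      integral_nonneg fun u => by positivity
    norm_num
    linarith
  · have hi := integrable_entry_pow (μ := μ) i j 3
    have hk := integrable_entry_pow (μ := μ) k j 3
    have hm := integrable_entry_monomial (μ := μ) i k j j 2 1
    have hm' := integrable_entry_monomial (μ := μ) k i j j 2 1
    simp only [pow_one] at hm hm'
    have h := integral_rotated_pow (μ := μ) hik j 3
    have h2 := integral_mono_of_nonneg (μ := μ) (ae_of_all _ fun u => by positivity)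
      (((hi.fun_add hk).div_const 4).fun_add ((hm.fun_add hm').const_mul (15 / 4)))
      (ae_of_all _ fun u => norm_rotated_sixth_le (u.1 i j) (u.1 k j))
    rw [← h] at h2
    rw [integral_add ((hi.fun_add hk).div_const 4) ((hm.fun_add hm').const_mul (15 / 4))] at h2
    rw [integral_div, integral_add hi hk, integral_const_mul, integral_add hm hm'] at h2
    linarith

/-- Summed over all `(i, k)`, the mixed moments add up to `1` because columns are unit vectors,
while the left side becomes `2n` times the sum. -/
lemma sum_integral_entry_fourth_le (j : Fin n) :
    n * ∑ i, ∫ u : Matrix.unitaryGroup (Fin n) 𝕜, (‖u.1 i j‖ ^ 2) ^ 2 ∂μ ≤ 3 := by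
  have h := Finset.sum_le_sum fun i (_ : i ∈ Finset.univ) =>
    Finset.sum_le_sum fun k (_ : k ∈ Finset.univ) => integral_entry_fourth_add_le (μ := μ) i k j
  have hm (i k : Fin n) := integrable_entry_monomial (μ := μ) i k j j 1 1
  simp only [pow_one] at hm
  have h1 : ∑ i, ∑ k, ∫ u : Matrix.unitaryGroup (Fin n) 𝕜, (‖u.1 i j‖ ^ 2 * ‖u.1 k j‖ ^ 2) ∂μ
      = 1 := by
    simp_rw [← integral_finsetSum _ fun k _ => hm _ k]
    rw [← integral_finsetSum _ fun i _ => integrable_finsetSum _ fun k _ => hm i k]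
    simp_rw [← Finset.sum_mul_sum, sum_norm_sq_col]
    simp
  simp only [← Finset.mul_sum, h1, Finset.sum_add_distrib, Finset.sum_const, Finset.card_univ,
    Fintype.card_fin, nsmul_eq_mul] at h
  linarith

/-- Summing a mixed sixth moment over the index of its square factor leaves a fourth moment, so the
two bounds chain. -/
lemma sum_integral_entry_sixth_le (j : Fin n) :
    n * ∑ i, ∫ u : Matrix.unitaryGroup (Fin n) 𝕜, (‖u.1 i j‖ ^ 2) ^ 3 ∂μ ≤
      5 * ∑ i, ∫ u : Matrix.unitaryGroup (Fin n) 𝕜, (‖u.1 i j‖ ^ 2) ^ 2 ∂μ := by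
  have h := Finset.sum_le_sum fun i (_ : i ∈ Finset.univ) =>
    Finset.sum_le_sum fun k (_ : k ∈ Finset.univ) => integral_entry_sixth_add_le (μ := μ) i k j
  have hm (i k : Fin n) := integrable_entry_monomial (μ := μ) i k j j 2 1
  simp only [pow_one] at hm
  have h1 (i : Fin n) : ∑ k, ∫ u : Matrix.unitaryGroup (Fin n) 𝕜,
      ((‖u.1 i j‖ ^ 2) ^ 2 * ‖u.1 k j‖ ^ 2) ∂μ =
        ∫ u : Matrix.unitaryGroup (Fin n) 𝕜, (‖u.1 i j‖ ^ 2) ^ 2 ∂μ := by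
    simp_rw [← integral_finsetSum _ fun k _ => hm _ k, ← Finset.mul_sum, sum_norm_sq_col, mul_one]
  simp only [← Finset.mul_sum, Finset.sum_add_distrib, Finset.sum_const, Finset.card_univ,
    Fintype.card_fin, nsmul_eq_mul] at h
  rw [Finset.sum_comm (f := fun i k => ∫ u : Matrix.unitaryGroup (Fin n) 𝕜,
    ((‖u.1 k j‖ ^ 2) ^ 2 * ‖u.1 i j‖ ^ 2) ∂μ)] at h
  simp only [h1] at h
  linarith

lemma sum_sum_integral_entry_fourth_le :
    ∑ i, ∑ j, ∫ u : Matrix.unitaryGroup (Fin n) 𝕜, (‖u.1 i j‖ ^ 2) ^ 2 ∂μ ≤ 3 := by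
  rcases Nat.eq_zero_or_pos n with rfl | hn
  · simp
  rw [Finset.sum_comm]
  have hn' : (0 : ℝ) < n := by exact_mod_cast hn
  have h := Finset.sum_le_sum fun j (_ : j ∈ Finset.univ) =>
    sum_integral_entry_fourth_le (μ := μ) j
  simp only [← Finset.mul_sum, Finset.sum_const, Finset.card_univ,
    Fintype.card_fin, nsmul_eq_mul] at h
  exact le_of_mul_le_mul_left h hn'

lemma sum_sum_integral_entry_sixth_le :
    n * ∑ i, ∑ j, ∫ u : Matrix.unitaryGroup (Fin n) 𝕜, (‖u.1 i j‖ ^ 2) ^ 3 ∂μ ≤ 15 := by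
  have h := Finset.sum_le_sum fun j (_ : j ∈ Finset.univ) =>
    sum_integral_entry_sixth_le (μ := μ) j
  have h4 := sum_sum_integral_entry_fourth_le (μ := μ)
  rw [Finset.sum_comm] at h4 ⊢
  simp only [← Finset.mul_sum] at h
  linarith

/-! ### Row and column cube sums of the matrix of squared moduli -/

/-- The sum over the rows of the cubes of their euclidean norms. -/
def rowCubeSum {κ κ' : Type*} [Fintype κ] [Fintype κ'] (M : κ → κ' → ℝ) : ℝ :=
  ∑ i, √(∑ j, M i j ^ 2) ^ 3

/-- AM–GM on `√s`. The free parameter replaces the power `3/2` by polynomial moments, so `lam` can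
be optimized after taking expectations. -/
lemma sqrt_cube_le {s c lam : ℝ} (hs : 0 ≤ s) (hsc : s ^ 2 ≤ c) (hlam : 0 < lam) :
    √s ^ 3 ≤ (lam * s + lam⁻¹ * c) / 2 := by
  have h1 : √s ^ 3 = s * √s := by rw [pow_succ, Real.sq_sqrt hs]
  have h2 : √s ≤ (lam + lam⁻¹ * s) / 2 := by
    have h3 : √s * √s = s := Real.mul_self_sqrt hs
    have h4 : 0 ≤ lam⁻¹ * (lam - √s) ^ 2 := by positivity
    have h5 : lam⁻¹ * (lam - √s) ^ 2 = lam - 2 * √s + lam⁻¹ * s := by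
      field_simp
      nlinarith
    linarith
  rw [h1]
  have h6 := mul_le_mul_of_nonneg_left h2 hs
  have h7 := mul_le_mul_of_nonneg_left hsc (inv_nonneg.2 hlam.le)
  nlinarith

lemma rowCubeSum_le {κ κ' : Type*} [Fintype κ] [Fintype κ'] {M : κ → κ' → ℝ}
    (h0 : ∀ i j, 0 ≤ M i j) (h1 : ∀ i, ∑ j, M i j = 1) {lam : ℝ} (hlam : 0 < lam) :
    rowCubeSum M ≤ (lam * ∑ i, ∑ j, M i j ^ 2 + lam⁻¹ * ∑ i, ∑ j, M i j ^ 3) / 2 := by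
  rw [Finset.mul_sum, Finset.mul_sum, ← Finset.sum_add_distrib, Finset.sum_div]
  refine Finset.sum_le_sum fun i _ => sqrt_cube_le (by positivity) ?_ hlam
  -- Cauchy–Schwarz: `(∑ M²)² ≤ (∑ M)(∑ M³)`, with `∑ M = 1`.
  have h := Finset.sum_sq_le_sum_mul_sum_of_sq_le_mul (R := ℝ) Finset.univ
    (r := fun j => M i j ^ 2) (f := fun j => M i j) (g := fun j => M i j ^ 3)
    (fun j _ => h0 i j) (fun j _ => pow_nonneg (h0 i j) 3) (fun j _ => le_of_eq (by ring))
  rwa [h1, one_mul] at h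

lemma continuous_rowCubeSum_entries :
    Continuous fun u : Matrix.unitaryGroup (Fin n) 𝕜 => rowCubeSum fun i j => ‖u.1 i j‖ ^ 2 := by
  have (i j : Fin n) := continuous_norm_entry (𝕜 := 𝕜) i j
  unfold rowCubeSum
  fun_prop

lemma continuous_colCubeSum_entries :
    Continuous fun u : Matrix.unitaryGroup (Fin n) 𝕜 => rowCubeSum fun j i => ‖u.1 i j‖ ^ 2 := by
  have (i j : Fin n) := continuous_norm_entry (𝕜 := 𝕜) i j
  unfold rowCubeSum
  fun_prop

lemma rowCubeSum_nonneg {κ κ' : Type*} [Fintype κ] [Fintype κ'] (M : κ → κ' → ℝ) :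
    0 ≤ rowCubeSum M := by
  unfold rowCubeSum
  positivity

lemma integral_le_of_forall_le_moments (hn : 0 < n) {F : Matrix.unitaryGroup (Fin n) 𝕜 → ℝ}
    (hF : Continuous F) (hF0 : ∀ u, 0 ≤ F u)
    (h : ∀ u, ∀ lam > 0, F u ≤ (lam * ∑ i, ∑ j, (‖u.1 i j‖ ^ 2) ^ 2 +
      lam⁻¹ * ∑ i, ∑ j, (‖u.1 i j‖ ^ 2) ^ 3) / 2) :
    Integrable F μ ∧ ∫ u, F u ∂μ ≤ 9 * (√n)⁻¹ := by
  have hs : 0 < √(n : ℝ) := by positivity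
  have hi (a : ℕ) : Integrable (fun u : Matrix.unitaryGroup (Fin n) 𝕜 =>
      ∑ i, ∑ j, (‖u.1 i j‖ ^ 2) ^ a) μ :=
    integrable_finsetSum _ fun i _ => integrable_finsetSum _ fun j _ =>
      integrable_entry_pow i j a
  have hI (a : ℕ) : ∫ u : Matrix.unitaryGroup (Fin n) 𝕜, ∑ i, ∑ j, (‖u.1 i j‖ ^ 2) ^ a ∂μ =
      ∑ i, ∑ j, ∫ u : Matrix.unitaryGroup (Fin n) 𝕜, (‖u.1 i j‖ ^ 2) ^ a ∂μ := by
    rw [integral_finsetSum _ fun i _ => integrable_finsetSum _ fun j _ =>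
      integrable_entry_pow i j a]
    simp_rw [integral_finsetSum _ fun j _ => integrable_entry_pow (μ := μ) _ j a]
  -- The choice `lam = 1/√n` balances the moment bounds `3` and `15/n`: `(3/√n + √n * 15/n) / 2 =
  -- 9/√n`.
  have hint := (((hi 2).const_mul (√n)⁻¹).add ((hi 3).const_mul (√n)⁻¹⁻¹)).div_const 2
  have hle u := h u (√n)⁻¹ (by positivity)
  refine ⟨hint.mono' hF.aestronglyMeasurable (ae_of_all _ fun u => ?_), ?_⟩
  · rw [Real.norm_of_nonneg (hF0 u)]
    exact hle u
  · have h2 := integral_mono_of_nonneg (μ := μ) (ae_of_all _ hF0) hint (ae_of_all _ hle)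
    refine h2.trans ?_
    simp only [Pi.add_apply]
    rw [integral_div, integral_add ((hi 2).const_mul _) ((hi 3).const_mul _),
      integral_const_mul, integral_const_mul, hI, hI, inv_inv]
    have h4 := sum_sum_integral_entry_fourth_le (μ := μ)
    have h6 := sum_sum_integral_entry_sixth_le (μ := μ)
    set a := ∑ i, ∑ j, ∫ u : Matrix.unitaryGroup (Fin n) 𝕜, (‖u.1 i j‖ ^ 2) ^ 2 ∂μ
    set b := ∑ i, ∑ j, ∫ u : Matrix.unitaryGroup (Fin n) 𝕜, (‖u.1 i j‖ ^ 2) ^ 3 ∂μ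
    have hsq : √(n : ℝ) * √n = n := Real.mul_self_sqrt (by positivity)
    have h7 : √n * b ≤ 15 * (√n)⁻¹ := by
      rw [← hsq] at h6
      field_simp
      nlinarith
    have h8 : (√n)⁻¹ * a ≤ (√n)⁻¹ * 3 := by gcongr
    linarith

lemma integral_rowCubeSum_le (hn : 0 < n) :
    Integrable (fun u : Matrix.unitaryGroup (Fin n) 𝕜 => rowCubeSum fun i j => ‖u.1 i j‖ ^ 2) μ ∧
    ∫ u : Matrix.unitaryGroup (Fin n) 𝕜, (rowCubeSum fun i j => ‖u.1 i j‖ ^ 2) ∂μ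
      ≤ 9 * (√n)⁻¹ :=
  integral_le_of_forall_le_moments hn continuous_rowCubeSum_entries
    (fun _ => rowCubeSum_nonneg _)
    fun u _ hlam => rowCubeSum_le (fun _ _ => by positivity) (sum_norm_sq_row u) hlam

lemma integral_colCubeSum_le (hn : 0 < n) :
    Integrable (fun u : Matrix.unitaryGroup (Fin n) 𝕜 => rowCubeSum fun j i => ‖u.1 i j‖ ^ 2) μ ∧
    ∫ u : Matrix.unitaryGroup (Fin n) 𝕜, (rowCubeSum fun j i => ‖u.1 i j‖ ^ 2) ∂μ
      ≤ 9 * (√n)⁻¹ :=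
  integral_le_of_forall_le_moments hn continuous_colCubeSum_entries
    (fun _ => rowCubeSum_nonneg _)
    fun u lam hlam => by
      have h := rowCubeSum_le (M := fun j i => ‖u.1 i j‖ ^ 2) (fun _ _ => by positivity)
        (sum_norm_sq_col u) hlam
      rwa [Finset.sum_comm, Finset.sum_comm (f := fun j i => (‖u.1 i j‖ ^ 2) ^ 3)] at h

end Haar

/-! ### Second and third moments of sums of independent variables -/

section IndependentSums

variable {Ω κ : Type*} [MeasurableSpace Ω] {P : Measure Ω}

/-- The term linear in `c` has mean zero when `c` is centered and independent of `a`, which is what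
makes the induction for Rosenthal's inequality close. For `a ≥ 0 ≥ a + c` the claim reduces to `4(a²
+ 3ac + 3c²) = (2a + 3c)² + 3c² ≥ 0`. -/
lemma abs_add_cube_le (a c : ℝ) :
    |a + c| ^ 3 ≤ |a| ^ 3 + 3 * (a * |a| * c) + 3 * (|a| * c ^ 2) + |c| ^ 3 := by
  have key (a c : ℝ) (ha : 0 ≤ a) : |a + c| ^ 3 ≤ a ^ 3 + 3 * (a * a * c) + 3 * (a * c ^ 2) +
      |c| ^ 3 := by
    have h1 : 0 ≤ a * (2 * a + 3 * c) ^ 2 := by positivity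
    have h2 : 0 ≤ a * c ^ 2 := by positivity
    rcases le_total 0 (a + c) with h | h
    · rw [abs_of_nonneg h]
      have : c ^ 3 ≤ |c| ^ 3 := by rw [← abs_pow]; exact le_abs_self _
      linarith [show (a + c) ^ 3 = a ^ 3 + 3 * (a * a * c) + 3 * (a * c ^ 2) + c ^ 3 by ring]
    · rw [abs_of_nonpos h, abs_of_nonpos (by linarith : c ≤ 0)]
      nlinarith
  rcases le_total 0 a with ha | ha
  · rw [abs_of_nonneg ha]
    exact key a c ha
  · have := key (-a) (-c) (by linarith)
    rw [abs_neg c, show -a + -c = -(a + c) by ring, abs_neg] at this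
    rw [abs_of_nonpos ha]
    linarith

lemma integrable_abs_cube {z : Ω → ℝ} (hz : MemLp z 3 P) : Integrable (fun ω => |z ω| ^ 3) P := by
  have := hz.integrable_norm_pow (p := 3) (by norm_num)
  simpa using this

variable {z : κ → Ω → ℝ}

lemma memLp_three_sum (hL : ∀ i, MemLp (z i) 3 P) (s : Finset κ) :
    MemLp (fun ω => ∑ i ∈ s, z i ω) 3 P :=
  memLp_finsetSum s fun i _ => hL i

lemma indepFun_sum_of_notMem (hz : iIndepFun z P) (hm : ∀ i, Measurable (z i)) {s : Finset κ}
    {a : κ} (ha : a ∉ s) : IndepFun (fun ω => ∑ i ∈ s, z i ω) (z a) P := by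
  have := hz.indepFun_finsetSum_of_notMem hm ha
  convert this using 1
  ext ω
  simp

variable [IsProbabilityMeasure P]

lemma memLp_two_of_three {z : Ω → ℝ} (hz : MemLp z 3 P) : MemLp z 2 P :=
  hz.mono_exponent (by norm_num)

lemma integrable_of_memLp_three {z : Ω → ℝ} (hz : MemLp z 3 P) : Integrable z P :=
  hz.integrable (by norm_num)

lemma integrable_sq_of_memLp_three {z : Ω → ℝ} (hz : MemLp z 3 P) :
    Integrable (fun ω => z ω ^ 2) P :=
  (memLp_two_of_three hz).integrable_sq

lemma integral_sq_sum (hz : iIndepFun z P) (hm : ∀ i, Measurable (z i))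
    (hL : ∀ i, MemLp (z i) 3 P) (h0 : ∀ i, ∫ ω, z i ω ∂P = 0) (s : Finset κ) :
    ∫ ω, (∑ i ∈ s, z i ω) ^ 2 ∂P = ∑ i ∈ s, ∫ ω, z i ω ^ 2 ∂P := by
  classical
  induction s using Finset.induction_on with
  | empty => simp
  | insert a s ha ih =>
    have hind := indepFun_sum_of_notMem hz hm ha
    have hS := memLp_three_sum hL s
    have e : ∀ ω, (∑ i ∈ insert a s, z i ω) ^ 2 = (∑ i ∈ s, z i ω) ^ 2 +
        2 * ((∑ i ∈ s, z i ω) * z a ω) + z a ω ^ 2 := by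
      intro ω
      rw [Finset.sum_insert ha]
      ring
    have i1 := integrable_sq_of_memLp_three hS
    have i2 : Integrable (fun ω => 2 * ((∑ i ∈ s, z i ω) * z a ω)) P :=
      (hind.integrable_mul (integrable_of_memLp_three hS)
        (integrable_of_memLp_three (hL a))).const_mul 2
    have i3 := integrable_sq_of_memLp_three (hL a)
    simp_rw [e]
    rw [integral_add (i1.fun_add i2) i3, integral_add i1 i2, integral_const_mul,
      hind.integral_fun_mul_eq_mul_integral hS.1 (hL a).1, h0 a, ih, Finset.sum_insert ha]
    ring

lemma integral_abs_le_sqrt {S : Ω → ℝ} (hS : MemLp S 2 P) :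
    ∫ ω, |S ω| ∂P ≤ √(∫ ω, S ω ^ 2 ∂P) := by
  apply Real.le_sqrt_of_sq_le
  have h := variance_nonneg |S| P
  rw [variance_eq_sub hS.abs] at h
  simp only [Pi.pow_apply, Pi.abs_apply, sq_abs] at h
  linarith

/-- Rosenthal's inequality for the third moment. -/
lemma integral_abs_sum_cube_le (hz : iIndepFun z P) (hm : ∀ i, Measurable (z i))
    (hL : ∀ i, MemLp (z i) 3 P) (h0 : ∀ i, ∫ ω, z i ω ∂P = 0) (s : Finset κ) :
    ∫ ω, |∑ i ∈ s, z i ω| ^ 3 ∂P ≤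
      3 * √(∑ i ∈ s, ∫ ω, z i ω ^ 2 ∂P) * (∑ i ∈ s, ∫ ω, z i ω ^ 2 ∂P) +
        ∑ i ∈ s, ∫ ω, |z i ω| ^ 3 ∂P := by
  classical
  -- The square root grows with `s`; a fixed bound `B` for the final one lets the increments be
  -- added up.
  suffices H : ∀ B, √(∑ i ∈ s, ∫ ω, z i ω ^ 2 ∂P) ≤ B → ∫ ω, |∑ i ∈ s, z i ω| ^ 3 ∂P ≤
      3 * B * (∑ i ∈ s, ∫ ω, z i ω ^ 2 ∂P) + ∑ i ∈ s, ∫ ω, |z i ω| ^ 3 ∂P from H _ le_rfl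
  induction s using Finset.induction_on with
  | empty => simp
  | insert a s ha ih =>
    intro B hB
    have hv : 0 ≤ ∫ ω, z a ω ^ 2 ∂P := integral_nonneg fun ω => sq_nonneg _
    have hB' : √(∑ i ∈ s, ∫ ω, z i ω ^ 2 ∂P) ≤ B := by
      refine (Real.sqrt_le_sqrt ?_).trans hB
      rw [Finset.sum_insert ha]
      linarith
    have hind := indepFun_sum_of_notMem hz hm ha
    have hS := memLp_three_sum hL s
    have hSm : Measurable fun ω => ∑ i ∈ s, z i ω := by fun_prop
    have hind1 : IndepFun (fun ω => (∑ i ∈ s, z i ω) * |∑ i ∈ s, z i ω|) (z a) P :=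
      hind.comp (φ := fun x : ℝ => x * |x|) (by fun_prop) measurable_id
    have hind2 : IndepFun (fun ω => |∑ i ∈ s, z i ω|) (fun ω => z a ω ^ 2) P :=
      hind.comp (φ := fun x : ℝ => |x|) (ψ := fun x : ℝ => x ^ 2) (by fun_prop) (by fun_prop)
    have iS : Integrable (fun ω => (∑ i ∈ s, z i ω) * |∑ i ∈ s, z i ω|) P := by
      refine (integrable_sq_of_memLp_three hS).mono' (by fun_prop) (ae_of_all _ fun ω => ?_)
      rw [norm_mul, Real.norm_eq_abs, Real.norm_eq_abs, abs_abs, abs_mul_abs_self, sq]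
    have i1 := integrable_abs_cube hS
    have i2 : Integrable (fun ω => 3 * ((∑ i ∈ s, z i ω) * |∑ i ∈ s, z i ω| * z a ω)) P :=
      (hind1.integrable_mul iS (integrable_of_memLp_three (hL a))).const_mul 3
    have i3 : Integrable (fun ω => 3 * (|∑ i ∈ s, z i ω| * z a ω ^ 2)) P :=
      (hind2.integrable_mul (integrable_of_memLp_three hS).abs
        (integrable_sq_of_memLp_three (hL a))).const_mul 3
    have i4 := integrable_abs_cube (hL a)
    have hle := integral_mono_of_nonneg (μ := P) (f := fun ω => |∑ i ∈ insert a s, z i ω| ^ 3)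
      (ae_of_all _ fun ω => by positivity) (((i1.fun_add i2).fun_add i3).fun_add i4)
      (ae_of_all _ fun ω => by
        simp only [Finset.sum_insert ha]
        rw [add_comm (z a ω)]
        exact abs_add_cube_le _ _)
    rw [integral_add ((i1.fun_add i2).fun_add i3) i4, integral_add (i1.fun_add i2) i3,
      integral_add i1 i2, integral_const_mul, integral_const_mul,
      hind1.integral_fun_mul_eq_mul_integral iS.1 (hL a).1, h0 a,
      hind2.integral_fun_mul_eq_mul_integral hS.1.norm
        (integrable_sq_of_memLp_three (hL a)).1] at hle
    have hE : ∫ ω, |∑ i ∈ s, z i ω| ∂P ≤ B := by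
      refine (integral_abs_le_sqrt (memLp_two_of_three hS)).trans ?_
      rwa [integral_sq_sum hz hm hL h0]
    have h1 := mul_le_mul_of_nonneg_right hE hv
    have h2 := ih B hB'
    rw [Finset.sum_insert ha, Finset.sum_insert ha]
    linarith

end IndependentSums

/-! ### Taylor comparison of characteristic functions; centered families -/

section Replacement

/-- For `|x| ≤ 1` the exponential remainder gives `e < 4`; for `|x| ≥ 1` the triangle inequality
gives `2 + |x| + x²/2 ≤ (7/2)|x|³`. -/
lemma norm_exp_mul_I_sub_taylor_le (x : ℝ) :
    ‖Complex.exp (x * Complex.I) - (1 + x * Complex.I - x ^ 2 / 2)‖ ≤ 4 * |x| ^ 3 := by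
  rcases le_total |x| 1 with h | h
  · have h1 := Complex.norm_exp_sub_sum_le_norm_mul_exp (x * Complex.I) 3
    have h2 : ∑ m ∈ Finset.range 3, ((x : ℂ) * Complex.I) ^ m / m.factorial =
        1 + x * Complex.I - x ^ 2 / 2 := by
      simp only [Finset.sum_range_succ, Finset.sum_range_zero, Nat.factorial]
      push_cast
      linear_combination (x : ℂ) ^ 2 / 2 * Complex.I_sq
    rw [h2] at h1
    simp only [norm_mul, Complex.norm_I, Complex.norm_real, Real.norm_eq_abs, mul_one] at h1
    refine h1.trans ?_
    rw [mul_comm]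
    gcongr
    exact (Real.exp_le_exp.2 h).trans (by linarith [Real.exp_one_lt_d9])
  · have h1 : ‖(1 : ℂ) + x * Complex.I - x ^ 2 / 2‖ ≤ 1 + |x| + |x| ^ 2 / 2 := by
      refine (norm_sub_le _ _).trans ((add_le_add_left (norm_add_le _ _) _).trans ?_)
      simp
    refine (norm_sub_le _ _).trans ?_
    rw [Complex.norm_exp_ofReal_mul_I]
    nlinarith [mul_nonneg (sub_nonneg.2 h) (sub_nonneg.2 h), pow_le_pow_left₀ zero_le_one h 3,
      pow_le_pow_right₀ h (show 1 ≤ 3 by norm_num), pow_le_pow_right₀ h (show 2 ≤ 3 by norm_num)]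

lemma norm_prod_sub_prod_le {κ : Type*} (s : Finset κ) (a b : κ → ℂ) (ha : ∀ i, ‖a i‖ ≤ 1)
    (hb : ∀ i, ‖b i‖ ≤ 1) : ‖∏ i ∈ s, a i - ∏ i ∈ s, b i‖ ≤ ∑ i ∈ s, ‖a i - b i‖ := by
  classical
  induction s using Finset.induction_on with
  | empty => simp
  | insert i s hi ih =>
    rw [Finset.prod_insert hi, Finset.prod_insert hi, Finset.sum_insert hi]
    have e : a i * ∏ j ∈ s, a j - b i * ∏ j ∈ s, b j =
        (a i - b i) * ∏ j ∈ s, a j + b i * (∏ j ∈ s, a j - ∏ j ∈ s, b j) := by ring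
    rw [e]
    refine (norm_add_le _ _).trans ?_
    rw [norm_mul, norm_mul, norm_prod]
    refine add_le_add ?_ ?_
    · exact mul_le_of_le_one_right (norm_nonneg _)
        (Finset.prod_le_one (fun _ _ => norm_nonneg _) fun j _ => ha j)
    · exact (mul_le_of_le_one_left (norm_nonneg _) (hb i)).trans ih

variable {Ω : Type*} [MeasurableSpace Ω] {P : Measure Ω}

/-- A family of independent centered random vectors whose coordinates have third absolute moments
at most `ρ`. -/
structure IsCenteredFamily {κ ι : Type*} (x : κ → Ω → ι → ℝ) (ρ : ℝ) (P : Measure Ω) : Prop where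
  nonneg : 0 ≤ ρ
  measurable : ∀ i, Measurable (x i)
  indep : iIndepFun x P
  memLp_three : ∀ i l, MemLp (fun ω => x i ω l) 3 P
  integral_eq_zero : ∀ i l, ∫ ω, x i ω l ∂P = 0
  integral_abs_cube_le : ∀ i l, ∫ ω, |x i ω l| ^ 3 ∂P ≤ ρ

lemma IsCenteredFamily.eval_measurable {κ ι : Type*} {ρ : ℝ} {x : κ → Ω → ι → ℝ}
    (hx : IsCenteredFamily x ρ P) (i : κ) (l : ι) :
    Measurable fun ω => x i ω l :=
  (measurable_pi_apply l).comp (hx.measurable i)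

/-- The weighted coordinates `m i * x i l` of a centered family. -/
lemma IsCenteredFamily.weighted {κ ι : Type*} {ρ : ℝ} {x : κ → Ω → ι → ℝ}
    (hx : IsCenteredFamily x ρ P) (m : κ → ℝ) (l : ι) :
    iIndepFun (fun i ω => m i * x i ω l) P ∧ (∀ i, Measurable fun ω => m i * x i ω l) ∧
      (∀ i, MemLp (fun ω => m i * x i ω l) 3 P) ∧ ∀ i, ∫ ω, m i * x i ω l ∂P = 0 := by
  refine ⟨hx.indep.comp (fun i v => m i * v l) fun i => by fun_prop,
    fun i => (hx.eval_measurable i l).const_mul _, fun i => (hx.memLp_three i l).const_mul _,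
    fun i => ?_⟩
  rw [integral_const_mul, hx.integral_eq_zero, mul_zero]

variable [IsProbabilityMeasure P]

lemma integrable_exp_mul_I {f : Ω → ℝ} (hf : AEStronglyMeasurable f P) :
    Integrable (fun ω => Complex.exp (f ω * Complex.I)) P := by
  refine Integrable.of_bound (C := 1) ?_ (ae_of_all _ fun ω => ?_)
  · have he : Continuous fun x : ℝ => Complex.exp (x * Complex.I) := by fun_prop
    exact he.comp_aestronglyMeasurable hf
  · rw [Complex.norm_exp_ofReal_mul_I]

lemma norm_integral_exp_le_one (f : Ω → ℝ) :
    ‖∫ ω, Complex.exp (f ω * Complex.I) ∂P‖ ≤ 1 := by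
  refine (norm_integral_le_of_norm_le_const (C := 1) (ae_of_all _ fun ω => ?_)).trans (by simp)
  rw [Complex.norm_exp_ofReal_mul_I]

lemma norm_integral_exp_sub_taylor_le {f : Ω → ℝ} (hf : MemLp f 3 P) (h0 : ∫ ω, f ω ∂P = 0) :
    ‖∫ ω, Complex.exp (f ω * Complex.I) ∂P - (1 - ((∫ ω, f ω ^ 2 ∂P : ℝ) : ℂ) / 2)‖ ≤
      4 * ∫ ω, |f ω| ^ 3 ∂P := by
  have i1 := integrable_exp_mul_I hf.1
  have i2 : Integrable (fun ω => (f ω : ℂ) * Complex.I) P :=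
    (integrable_of_memLp_three hf).ofReal.mul_const _
  have i3 : Integrable (fun ω => (f ω : ℂ) ^ 2 / 2) P := by
    have := (integrable_sq_of_memLp_three hf).ofReal (𝕜 := ℂ)
    push_cast at this
    exact this.div_const 2
  have i4 : Integrable (fun ω => 1 + (f ω : ℂ) * Complex.I) P := (integrable_const 1).fun_add i2
  have i5 : Integrable (fun ω => 1 + (f ω : ℂ) * Complex.I - (f ω : ℂ) ^ 2 / 2) P := i4.sub i3
  have e : ∫ ω, Complex.exp (f ω * Complex.I) ∂P - (1 - ((∫ ω, f ω ^ 2 ∂P : ℝ) : ℂ) / 2) =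
      ∫ ω, (Complex.exp (f ω * Complex.I) - (1 + f ω * Complex.I - f ω ^ 2 / 2)) ∂P := by
    rw [integral_sub i1 i5, integral_sub i4 i3, integral_add (integrable_const 1) i2,
      integral_mul_const, integral_div, integral_complex_ofReal, h0, ← integral_complex_ofReal]
    simp
  rw [e, ← integral_const_mul]
  exact norm_integral_le_of_norm_le ((integrable_abs_cube hf).const_mul 4)
    (ae_of_all _ fun ω => norm_exp_mul_I_sub_taylor_le (f ω))

/-- Both characteristic functions are compared with the same second order Taylor polynomial. -/
lemma norm_integral_exp_sub_integral_exp_le {f g : Ω → ℝ} (hf : MemLp f 3 P) (hg : MemLp g 3 P)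
    (hf0 : ∫ ω, f ω ∂P = 0) (hg0 : ∫ ω, g ω ∂P = 0)
    (hfg : ∫ ω, f ω ^ 2 ∂P = ∫ ω, g ω ^ 2 ∂P) :
    ‖∫ ω, Complex.exp (f ω * Complex.I) ∂P - ∫ ω, Complex.exp (g ω * Complex.I) ∂P‖ ≤
      4 * (∫ ω, |f ω| ^ 3 ∂P + ∫ ω, |g ω| ^ 3 ∂P) := by
  have h1 := norm_integral_exp_sub_taylor_le hf hf0
  have h2 := norm_integral_exp_sub_taylor_le hg hg0
  rw [norm_sub_rev, ← hfg] at h2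
  have h3 := norm_sub_le_norm_sub_add_norm_sub (∫ ω, Complex.exp (f ω * Complex.I) ∂P)
    (1 - ((∫ ω, f ω ^ 2 ∂P : ℝ) : ℂ) / 2) (∫ ω, Complex.exp (g ω * Complex.I) ∂P)
  linarith

variable {κ κ' ι : Type*} {ρ : ℝ}

lemma abs_sum_cube_le [Fintype ι] (f : ι → ℝ) :
    |∑ l, f l| ^ 3 ≤ (Fintype.card ι : ℝ) ^ 2 * ∑ l, |f l| ^ 3 := by
  refine (pow_le_pow_left₀ (abs_nonneg _) (Finset.abs_sum_le_sum_abs f Finset.univ) 3).trans ?_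
  exact pow_sum_le_card_mul_sum_pow (fun _ _ => abs_nonneg _) 2

namespace IsCenteredFamily

variable {x : κ → Ω → ι → ℝ}

lemma integral_sq_le (hx : IsCenteredFamily x ρ P) (i : κ) (l : ι) :
    ∫ ω, x i ω l ^ 2 ∂P ≤ 1 + ρ := by
  have h := integral_mono (integrable_sq_of_memLp_three (hx.memLp_three i l))
    ((integrable_const (1 : ℝ)).fun_add (integrable_abs_cube (hx.memLp_three i l))) fun ω => by
      change x i ω l ^ 2 ≤ 1 + |x i ω l| ^ 3
      rw [← sq_abs]
      have := abs_nonneg (x i ω l)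
      rcases le_total |x i ω l| 1 with h | h
      · nlinarith [pow_le_one₀ this h (n := 2), pow_nonneg this 3]
      · nlinarith [pow_le_pow_right₀ h (show 2 ≤ 3 by norm_num)]
  rw [integral_add (integrable_const _) (integrable_abs_cube (hx.memLp_three i l))] at h
  simp only [integral_const, probReal_univ, one_smul] at h
  linarith [hx.integral_abs_cube_le i l]

variable [Fintype κ]

lemma integral_sq_weighted_sum_le (hx : IsCenteredFamily x ρ P) (m : κ → ℝ) (l : ι) :
    ∫ ω, (∑ i, m i * x i ω l) ^ 2 ∂P ≤ (1 + ρ) * ∑ i, m i ^ 2 := by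
  obtain ⟨h1, h2, h3, h4⟩ := hx.weighted m l
  rw [integral_sq_sum h1 h2 h3 h4, Finset.mul_sum]
  refine Finset.sum_le_sum fun i _ => ?_
  simp_rw [mul_pow]
  rw [integral_const_mul, mul_comm]
  exact mul_le_mul_of_nonneg_right (hx.integral_sq_le i l) (sq_nonneg _)

/-- In Rosenthal's inequality, with `s = ∑ m i ^ 2`, the variance is at most `(1 + ρ) * s`, and `|m
i| ≤ √s` bounds the cubic part by `ρ * s * √s`. -/
lemma integral_cube_weighted_sum_le (hx : IsCenteredFamily x ρ P) (m : κ → ℝ)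
    (l : ι) :
    ∫ ω, |∑ i, m i * x i ω l| ^ 3 ∂P ≤
      (3 * (√(1 + ρ) * (1 + ρ)) + ρ) * √(∑ i, m i ^ 2) ^ 3 := by
  have hρ := hx.nonneg
  obtain ⟨h1, h2, h3, h4⟩ := hx.weighted m l
  refine (integral_abs_sum_cube_le h1 h2 h3 h4 _).trans ?_
  have hsq := hx.integral_sq_weighted_sum_le m l
  rw [integral_sq_sum h1 h2 h3 h4] at hsq
  have hpos : 0 ≤ ∑ i, ∫ ω, (m i * x i ω l) ^ 2 ∂P :=
    Finset.sum_nonneg fun i _ => integral_nonneg fun ω => sq_nonneg _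
  set A := ∑ i, ∫ ω, (m i * x i ω l) ^ 2 ∂P
  set s := ∑ i, m i ^ 2 with hs
  have hs0 : 0 ≤ s := by positivity
  have hss : √s ^ 3 = s * √s := by rw [pow_succ, Real.sq_sqrt hs0]
  have hc : ∑ i, ∫ ω, |m i * x i ω l| ^ 3 ∂P ≤ ρ * √s ^ 3 := by
    rw [hss, hs, Finset.sum_mul, Finset.mul_sum]
    refine Finset.sum_le_sum fun i _ => ?_
    simp_rw [abs_mul, mul_pow]
    rw [integral_const_mul, mul_comm]
    refine mul_le_mul (hx.integral_abs_cube_le i l) ?_ (by positivity) hx.nonneg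
    have hi : |m i| ≤ √s := by
      rw [← Real.sqrt_sq_eq_abs]
      exact Real.sqrt_le_sqrt (Finset.single_le_sum (f := fun i => m i ^ 2)
        (fun _ _ => sq_nonneg _) (Finset.mem_univ i))
    rw [pow_succ, sq_abs]
    gcongr
  have hA : √A * A ≤ (√(1 + ρ) * (1 + ρ)) * (s * √s) := by
    calc √A * A ≤ √((1 + ρ) * s) * ((1 + ρ) * s) := by gcongr
      _ = _ := by rw [Real.sqrt_mul (by linarith)]; ring
  rw [hss] at hc ⊢
  linarith

end IsCenteredFamily

end Replacement

/-! ### Moments of linear forms in the coordinates -/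

section LinearForms

namespace IsCenteredFamily

variable {Ω κ ι : Type*} [MeasurableSpace Ω] {P : Measure Ω} {ρ : ℝ} [Fintype ι]
  {x : κ → Ω → ι → ℝ}

lemma memLp_three_linear (hx : IsCenteredFamily x ρ P) (w : ι → ℝ) (i : κ) :
    MemLp (fun ω => ∑ l, w l * x i ω l) 3 P :=
  memLp_finsetSum _ fun l _ => (hx.memLp_three i l).const_mul _

lemma integral_linear_cube_le (hx : IsCenteredFamily x ρ P) (w : ι → ℝ) (i : κ) :
    ∫ ω, |∑ l, w l * x i ω l| ^ 3 ∂P ≤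
      (Fintype.card ι : ℝ) ^ 2 * (ρ * ∑ l, |w l| ^ 3) := by
  have hint l := (integrable_abs_cube (hx.memLp_three i l)).const_mul (|w l| ^ 3)
  refine (integral_mono (integrable_abs_cube (hx.memLp_three_linear w i))
    ((integrable_finsetSum Finset.univ fun l _ => hint l).const_mul ((Fintype.card ι : ℝ) ^ 2))
    fun ω => ?_).trans ?_
  · refine (abs_sum_cube_le _).trans_eq ?_
    simp only [abs_mul, mul_pow]
  · rw [integral_const_mul, integral_finsetSum _ fun l _ => hint l]
    refine mul_le_mul_of_nonneg_left ?_ (sq_nonneg _)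
    rw [Finset.mul_sum]
    refine Finset.sum_le_sum fun l _ => ?_
    rw [integral_const_mul, mul_comm]
    exact mul_le_mul_of_nonneg_right (hx.integral_abs_cube_le i l) (by positivity)

variable [IsProbabilityMeasure P]

lemma integral_linear (hx : IsCenteredFamily x ρ P) (w : ι → ℝ) (i : κ) :
    ∫ ω, ∑ l, w l * x i ω l ∂P = 0 := by
  rw [integral_finsetSum _ fun l _ =>
    (integrable_of_memLp_three (hx.memLp_three i l)).const_mul _]
  simp [integral_const_mul, hx.integral_eq_zero]

lemma integral_linear_sq (hx : IsCenteredFamily x ρ P) (w : ι → ℝ) (i : κ) :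
    ∫ ω, (∑ l, w l * x i ω l) ^ 2 ∂P =
      ∑ l, ∑ l', w l * w l' * ∫ ω, x i ω l * x i ω l' ∂P := by
  have hint l l' : Integrable (fun ω => w l * w l' * (x i ω l * x i ω l')) P :=
    ((memLp_two_of_three (hx.memLp_three i l)).integrable_mul
      (memLp_two_of_three (hx.memLp_three i l'))).const_mul _
  have e ω : (∑ l, w l * x i ω l) ^ 2 = ∑ l, ∑ l', w l * w l' * (x i ω l * x i ω l') := by
    rw [sq, Finset.sum_mul_sum]
    exact Finset.sum_congr rfl fun l _ => Finset.sum_congr rfl fun l' _ => by ring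
  simp_rw [e]
  rw [integral_finsetSum _ fun l _ => integrable_finsetSum _ fun l' _ => hint l l']
  simp_rw [integral_finsetSum _ fun l' _ => hint _ l', integral_const_mul]

end IsCenteredFamily

end LinearForms

/-! ### Replacement of the inputs for a fixed matrix -/

section Phase

variable {κ κ' ι : Type*} [Fintype κ] [Fintype κ'] [Fintype ι]

/-- The form `∑ i j l, t l * M i j * x i l * y j l`. -/
def phase (M : κ → κ' → ℝ) (t : ι → ℝ) (x : κ → ι → ℝ) (y : κ' → ι → ℝ) : ℝ :=
  ∑ i, ∑ l, (t l * ∑ j, M i j * y j l) * x i l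

/-- This symmetry reduces replacement of the `y j` to replacement of the `x i` for the transposed
matrix. -/
lemma phase_comm (M : κ → κ' → ℝ) (t : ι → ℝ) (x : κ → ι → ℝ) (y : κ' → ι → ℝ) :
    phase M t x y = phase (fun j i => M i j) t y x := by
  simp only [phase, Finset.mul_sum, Finset.sum_mul]
  rw [Finset.sum_congr rfl fun i _ => Finset.sum_comm, Finset.sum_comm]
  refine Finset.sum_congr rfl fun j _ => ?_
  rw [Finset.sum_comm]
  refine Finset.sum_congr rfl fun l _ => Finset.sum_congr rfl fun i _ => ?_
  ring

variable {Ω : Type*} [MeasurableSpace Ω] {P : Measure Ω} {ρ : ℝ}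

lemma measurable_phase {α : Type*} [MeasurableSpace α] {M : α → κ → κ' → ℝ} (t : ι → ℝ)
    {x : κ → α → ι → ℝ} {y : κ' → α → ι → ℝ} (hM : ∀ i j, Measurable fun a => M a i j)
    (hx : ∀ i, Measurable (x i)) (hy : ∀ j, Measurable (y j)) :
    Measurable fun a => phase (M a) t (fun i => x i a) (fun j => y j a) := by
  have hx' i l : Measurable fun a => x i a l := (measurable_pi_apply l).comp (hx i)
  have hy' j l : Measurable fun a => y j a l := (measurable_pi_apply l).comp (hy j)
  unfold phase
  fun_prop

variable [IsProbabilityMeasure P]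

/-- Expectation of a function of two independent variables as an iterated integral. -/
lemma integral_comp_of_indepFun {α β : Type*} [MeasurableSpace α] [MeasurableSpace β]
    {f : Ω → α} {g : Ω → β} (h : IndepFun f g P) (hf : Measurable f) (hg : Measurable g)
    {F : α × β → ℝ} (hF : Measurable F) :
    ∫ ω, Complex.exp (F (f ω, g ω) * Complex.I) ∂P =
      ∫ ω', ∫ ω, Complex.exp (F (f ω, g ω') * Complex.I) ∂P ∂P := by
  have hF' : Measurable fun p => Complex.exp (F p * Complex.I) := by fun_prop
  rw [← integral_map (f := fun p => Complex.exp (F p * Complex.I)) (hf.prodMk hg).aemeasurable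
    hF'.aestronglyMeasurable, h.map_prod_eq_prod_map_map hf.aemeasurable hg.aemeasurable,
    Measure.map_prod_map _ _ hf hg, integral_map (by fun_prop) hF'.aestronglyMeasurable,
    integral_prod_symm]
  · rfl
  · have : Measurable fun p : Ω × Ω => F (Prod.map f g p) := by fun_prop
    exact integrable_exp_mul_I this.aestronglyMeasurable

lemma lintegral_comp_of_indepFun {α β : Type*} [MeasurableSpace α] [MeasurableSpace β]
    {f : Ω → α} {g : Ω → β} (h : IndepFun f g P) (hf : Measurable f) (hg : Measurable g)
    {F : α × β → ENNReal} (hF : Measurable F) :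
    ∫⁻ ω, F (f ω, g ω) ∂P = ∫⁻ ω', ∫⁻ ω, F (f ω, g ω') ∂P ∂P := by
  rw [← lintegral_map (f := F) hF (hf.prodMk hg),
    h.map_prod_eq_prod_map_map hf.aemeasurable hg.aemeasurable,
    Measure.map_prod_map _ _ hf hg, lintegral_map hF (by fun_prop),
    lintegral_prod_symm _ (by fun_prop)]
  rfl

namespace IsCenteredFamily

section Linear

variable {x x' : κ → Ω → ι → ℝ}

/-- Lindeberg replacement for a linear form in independent centered vectors. -/
lemma norm_integral_exp_linear_sub_le (hx : IsCenteredFamily x ρ P) (hx' : IsCenteredFamily x' ρ P)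
    (hcov : ∀ i l l', ∫ ω, x i ω l * x i ω l' ∂P = ∫ ω, x' i ω l * x' i ω l' ∂P)
    (w : κ → ι → ℝ) :
    ‖∫ ω, Complex.exp ((∑ i, ∑ l, w i l * x i ω l : ℝ) * Complex.I) ∂P -
        ∫ ω, Complex.exp ((∑ i, ∑ l, w i l * x' i ω l : ℝ) * Complex.I) ∂P‖ ≤
      8 * (Fintype.card ι : ℝ) ^ 2 * ρ * ∑ i, ∑ l, |w i l| ^ 3 := by
  have hprod {z : κ → Ω → ι → ℝ} (hz : IsCenteredFamily z ρ P) :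
      ∫ ω, Complex.exp ((∑ i, ∑ l, w i l * z i ω l : ℝ) * Complex.I) ∂P =
        ∏ i, ∫ ω, Complex.exp ((∑ l, w i l * z i ω l : ℝ) * Complex.I) ∂P := by
    have hm i : Measurable fun v : ι → ℝ => ∑ l, w i l * v l := by fun_prop
    have he : Continuous fun r : ℝ => Complex.exp (r * Complex.I) := by fun_prop
    have h := (hz.indep.comp _ hm).integral_fun_prod_comp
      (f := fun _ (r : ℝ) => Complex.exp (r * Complex.I))
      (fun i => ((hm i).comp (hz.measurable i)).aemeasurable)
      (fun i => he.aestronglyMeasurable)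
    simp only [Function.comp_def] at h
    rw [← h]
    refine integral_congr_ae (ae_of_all _ fun ω => ?_)
    simp only [← Complex.exp_sum, ← Finset.sum_mul, Complex.ofReal_sum]
  rw [hprod hx, hprod hx']
  refine (norm_prod_sub_prod_le _ _ _ (fun i => norm_integral_exp_le_one _)
    fun i => norm_integral_exp_le_one _).trans ?_
  rw [Finset.mul_sum]
  refine Finset.sum_le_sum fun i _ => ?_
  refine (norm_integral_exp_sub_integral_exp_le (hx.memLp_three_linear _ i)
    (hx'.memLp_three_linear _ i) (hx.integral_linear _ i) (hx'.integral_linear _ i) ?_).trans ?_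
  · rw [hx.integral_linear_sq, hx'.integral_linear_sq]
    simp only [hcov]
  · linarith [hx.integral_linear_cube_le (w i) i, hx'.integral_linear_cube_le (w i) i]

end Linear

/-- The constant in the replacement bound. -/
def _root_.RandomTruncation.replacementConst (ρ : ℝ) (t : ι → ℝ) : ℝ :=
  8 * (Fintype.card ι : ℝ) ^ 2 * ρ * ((∑ l, |t l| ^ 3) * (3 * (√(1 + ρ) * (1 + ρ)) + ρ))

variable {x x' : κ → Ω → ι → ℝ} {y y' : κ' → Ω → ι → ℝ}

lemma integral_sum_cube_le (hy : IsCenteredFamily y ρ P) (M : κ → κ' → ℝ) (t : ι → ℝ) :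
    Integrable (fun ω => ∑ i, ∑ l, |t l * ∑ j, M i j * y j ω l| ^ 3) P ∧
    ∫ ω, ∑ i, ∑ l, |t l * ∑ j, M i j * y j ω l| ^ 3 ∂P ≤
      ((∑ l, |t l| ^ 3) * (3 * (√(1 + ρ) * (1 + ρ)) + ρ)) * rowCubeSum M := by
  have hint i l : Integrable (fun ω => |t l * ∑ j, M i j * y j ω l| ^ 3) P := by
    apply integrable_abs_cube
    exact (memLp_three_sum (hy.weighted (M i) l).2.2.1 Finset.univ).const_mul _
  refine ⟨integrable_finsetSum _ fun i _ => integrable_finsetSum _ fun l _ => hint i l, ?_⟩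
  rw [integral_finsetSum _ fun i _ => integrable_finsetSum _ fun l _ => hint i l, rowCubeSum,
    Finset.mul_sum]
  refine Finset.sum_le_sum fun i _ => ?_
  rw [integral_finsetSum _ fun l _ => hint i l, mul_assoc, Finset.sum_mul]
  refine Finset.sum_le_sum fun l _ => ?_
  simp_rw [abs_mul, mul_pow]
  rw [integral_const_mul]
  exact mul_le_mul_of_nonneg_left (hy.integral_cube_weighted_sum_le (M i) l) (by positivity)

lemma integrable_exp_phase_prod (hx : IsCenteredFamily x ρ P) (hy : IsCenteredFamily y ρ P)
    (M : κ → κ' → ℝ) (t : ι → ℝ) :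
    Integrable (fun p : Ω × Ω =>
      Complex.exp (phase M t (fun i => x i p.1) (fun j => y j p.2) * Complex.I)) (P.prod P) := by
  apply integrable_exp_mul_I
  exact (measurable_phase (M := fun _ => M) t (fun _ _ => measurable_const)
    (fun i => (hx.measurable i).comp measurable_fst)
    (fun j => (hy.measurable j).comp measurable_snd)).aestronglyMeasurable

lemma norm_integral_exp_phase_sub_left_le (hx : IsCenteredFamily x ρ P)
    (hx' : IsCenteredFamily x' ρ P) (hy : IsCenteredFamily y ρ P)
    (hcov : ∀ i l l', ∫ ω, x i ω l * x i ω l' ∂P = ∫ ω, x' i ω l * x' i ω l' ∂P)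
    (M : κ → κ' → ℝ) (t : ι → ℝ) :
    ‖(∫ ω', ∫ ω, Complex.exp (phase M t (fun i => x i ω) (fun j => y j ω') * Complex.I) ∂P ∂P) -
      ∫ ω', ∫ ω, Complex.exp (phase M t (fun i => x' i ω) (fun j => y j ω') * Complex.I) ∂P ∂P‖ ≤
      replacementConst ρ t * rowCubeSum M := by
  rw [← integral_sub (hx.integrable_exp_phase_prod hy M t).integral_prod_right
    (hx'.integrable_exp_phase_prod hy M t).integral_prod_right]
  obtain ⟨hint, hle⟩ := hy.integral_sum_cube_le M t
  refine (norm_integral_le_of_norm_le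
    (hint.const_mul (8 * (Fintype.card ι : ℝ) ^ 2 * ρ)) (ae_of_all _ fun ω' =>
      hx.norm_integral_exp_linear_sub_le hx' hcov fun i l => t l * ∑ j, M i j * y j ω' l)).trans ?_
  rw [integral_const_mul, replacementConst, mul_assoc _ _ (rowCubeSum M)]
  exact mul_le_mul_of_nonneg_left hle (by have := hx.nonneg; positivity)

lemma norm_integral_exp_phase_sub_right_le (hx : IsCenteredFamily x ρ P)
    (hy : IsCenteredFamily y ρ P) (hy' : IsCenteredFamily y' ρ P)
    (hcov : ∀ i l l', ∫ ω, y i ω l * y i ω l' ∂P = ∫ ω, y' i ω l * y' i ω l' ∂P)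
    (M : κ → κ' → ℝ) (t : ι → ℝ) :
    ‖(∫ ω', ∫ ω, Complex.exp (phase M t (fun i => x i ω) (fun j => y j ω') * Complex.I) ∂P ∂P) -
      ∫ ω', ∫ ω, Complex.exp (phase M t (fun i => x i ω) (fun j => y' j ω') * Complex.I) ∂P ∂P‖ ≤
      replacementConst ρ t * rowCubeSum fun j i => M i j := by
  have h := hy.norm_integral_exp_phase_sub_left_le hy' hx hcov (fun j i => M i j) t
  -- In `h` the family being replaced is integrated first; Fubini restores the order of the
  -- statement.
  rw [← integral_prod_symm _ (hy.integrable_exp_phase_prod hx _ t),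
    ← integral_prod_symm _ (hy'.integrable_exp_phase_prod hx _ t),
    integral_prod _ (hy.integrable_exp_phase_prod hx _ t),
    integral_prod _ (hy'.integrable_exp_phase_prod hx _ t)] at h
  simpa only [phase_comm M] using h

/-- Replacement in both arguments of the phase, for a fixed matrix. -/
lemma norm_integral_exp_phase_sub_le (hx : IsCenteredFamily x ρ P)
    (hx' : IsCenteredFamily x' ρ P) (hy : IsCenteredFamily y ρ P) (hy' : IsCenteredFamily y' ρ P)
    (hxy : IndepFun (fun ω i => x i ω) (fun ω j => y j ω) P)
    (hxy' : IndepFun (fun ω i => x' i ω) (fun ω j => y' j ω) P)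
    (hcov : ∀ i l l', ∫ ω, x i ω l * x i ω l' ∂P = ∫ ω, x' i ω l * x' i ω l' ∂P)
    (hcov' : ∀ i l l', ∫ ω, y i ω l * y i ω l' ∂P = ∫ ω, y' i ω l * y' i ω l' ∂P)
    (M : κ → κ' → ℝ) (t : ι → ℝ) :
    ‖(∫ ω, Complex.exp (phase M t (fun i => x i ω) (fun j => y j ω) * Complex.I) ∂P) -
      ∫ ω, Complex.exp (phase M t (fun i => x' i ω) (fun j => y' j ω) * Complex.I) ∂P‖ ≤
      replacementConst ρ t * (rowCubeSum M + rowCubeSum fun j i => M i j) := by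
  have hm : Measurable fun p : (κ → ι → ℝ) × (κ' → ι → ℝ) => phase M t p.1 p.2 :=
    measurable_phase (α := (κ → ι → ℝ) × (κ' → ι → ℝ)) (M := fun _ => M)
      (x := fun i p => p.1 i) (y := fun j p => p.2 j) t (fun _ _ => measurable_const)
      (fun i => (measurable_pi_apply i).comp measurable_fst)
      (fun j => (measurable_pi_apply j).comp measurable_snd)
  have e := integral_comp_of_indepFun hxy (measurable_pi_lambda _ hx.measurable)
    (measurable_pi_lambda _ hy.measurable) hm
  have e' := integral_comp_of_indepFun hxy' (measurable_pi_lambda _ hx'.measurable)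
    (measurable_pi_lambda _ hy'.measurable) hm
  rw [e, e', mul_add]
  -- The intermediate term has `x` already replaced and `y` not yet.
  refine (norm_sub_le_norm_sub_add_norm_sub _ (∫ ω', ∫ ω,
    Complex.exp (phase M t (fun i => x' i ω) (fun j => y j ω') * Complex.I) ∂P ∂P) _).trans ?_
  exact add_le_add (hx.norm_integral_exp_phase_sub_left_le hx' hy hcov M t)
    (hx'.norm_integral_exp_phase_sub_right_le hy hy' hcov' M t)

end IsCenteredFamily

end Phase

/-! ### Second moment of the bilinear form -/

section SecondMoment

namespace IsCenteredFamily

variable {κ κ' ι Ω : Type*} [Fintype κ] [Fintype κ'] [MeasurableSpace Ω] {P : Measure Ω}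
  [IsProbabilityMeasure P] {ρ : ℝ} {x : κ → Ω → ι → ℝ} {y : κ' → Ω → ι → ℝ}

/-- Orthogonality of independent centered variables is used once for `x` with `y` frozen, then once
for `y`; each use costs a factor `1 + ρ`. Lower integrals avoid any prior integrability of the
bilinear form. -/
lemma lintegral_sq_bilinear_le (hx : IsCenteredFamily x ρ P) (hy : IsCenteredFamily y ρ P)
    (hxy : IndepFun (fun ω i => x i ω) (fun ω j => y j ω) P) (M : κ → κ' → ℝ) (l : ι) :
    ∫⁻ ω, ENNReal.ofReal ((∑ i, ∑ j, M i j * x i ω l * y j ω l) ^ 2) ∂P ≤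
      ENNReal.ofReal ((1 + ρ) ^ 2 * ∑ i, ∑ j, M i j ^ 2) := by
  have hρ := hx.nonneg
  have hm : Measurable fun p : (κ → ι → ℝ) × (κ' → ι → ℝ) =>
      ENNReal.ofReal ((∑ i, ∑ j, M i j * p.1 i l * p.2 j l) ^ 2) := by
    have h1 (i : κ) : Measurable fun p : (κ → ι → ℝ) × (κ' → ι → ℝ) => p.1 i l := by fun_prop
    have h2 (j : κ') : Measurable fun p : (κ → ι → ℝ) × (κ' → ι → ℝ) => p.2 j l := by fun_prop
    fun_prop
  rw [lintegral_comp_of_indepFun hxy (measurable_pi_lambda _ hx.measurable)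
      (measurable_pi_lambda _ hy.measurable) hm]
  have hint i : Integrable (fun ω => (∑ j, M i j * y j ω l) ^ 2) P :=
    integrable_sq_of_memLp_three (memLp_three_sum (hy.weighted (M i) l).2.2.1 Finset.univ)
  calc _ ≤ ∫⁻ ω', ENNReal.ofReal ((1 + ρ) * ∑ i, (∑ j, M i j * y j ω' l) ^ 2) ∂P := by
        refine lintegral_mono fun ω' => ?_
        have e ω : ∑ i, ∑ j, M i j * x i ω l * y j ω' l =
            ∑ i, (∑ j, M i j * y j ω' l) * x i ω l := by
          simp only [Finset.sum_mul]
          exact Finset.sum_congr rfl fun i _ => Finset.sum_congr rfl fun j _ => by ring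
        simp only [e]
        rw [← ofReal_integral_eq_lintegral_ofReal]
        · exact ENNReal.ofReal_le_ofReal (hx.integral_sq_weighted_sum_le _ l)
        · exact integrable_sq_of_memLp_three
            (memLp_three_sum (hx.weighted _ l).2.2.1 Finset.univ)
        · exact ae_of_all _ fun ω => sq_nonneg _
    _ ≤ _ := by
        rw [← ofReal_integral_eq_lintegral_ofReal]
        · apply ENNReal.ofReal_le_ofReal
          rw [integral_const_mul, integral_finsetSum _ fun i _ => hint i, sq, mul_assoc]
          refine mul_le_mul_of_nonneg_left ?_ (by positivity)
          rw [Finset.mul_sum]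
          exact Finset.sum_le_sum fun i _ => hy.integral_sq_weighted_sum_le (M i) l
        · exact (integrable_finsetSum _ fun i _ => hint i).const_mul _
        · exact ae_of_all _ fun ω => by positivity

end IsCenteredFamily

end SecondMoment

/-! ### Tightness and passage from characteristic functions to laws -/

section Limit

variable {Ω E : Type*} [MeasurableSpace Ω] {P : Measure Ω}

/-- Chebyshev's inequality in each coordinate and a union bound for the sup norm. -/
lemma isTightMeasureSet_of_lintegral_sq_le {ι : Type*} [Fintype ι] {A : ℕ → Ω → ι → ℝ}
    (hA : ∀ n, Measurable (A n)) {C : ℝ}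
    (h : ∀ n l, ∫⁻ ω, ENNReal.ofReal (A n ω l ^ 2) ∂P ≤ ENNReal.ofReal C) :
    IsTightMeasureSet (Set.range fun n => P.map (A n)) := by
  apply isTightMeasureSet_of_tendsto_measure_norm_gt
  have hbound : ∀ᶠ r : ℝ in atTop, ⨆ m ∈ Set.range (fun n => P.map (A n)), m {x | r < ‖x‖} ≤
      ENNReal.ofReal (Fintype.card ι * C * (r ^ 2)⁻¹) := by
    filter_upwards [eventually_gt_atTop 0] with r hr
    refine iSup₂_le ?_
    rintro _ ⟨n, rfl⟩
    rw [Measure.map_apply (hA n) (measurableSet_lt measurable_const measurable_norm)]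
    have hr2 : 0 < r ^ 2 := by positivity
    have hsub : (A n) ⁻¹' {x | r < ‖x‖} ⊆
        ⋃ l, {ω | ENNReal.ofReal (r ^ 2) ≤ ENNReal.ofReal (A n ω l ^ 2)} := by
      intro ω hω
      simp only [Set.mem_preimage, Set.mem_ofPred_eq] at hω
      by_contra hcon
      simp only [Set.mem_iUnion, Set.mem_ofPred_eq, not_exists, not_le] at hcon
      refine hω.not_ge ((pi_norm_le_iff_of_nonneg hr.le).2 fun l => ?_)
      have := (ENNReal.ofReal_lt_ofReal_iff hr2).1 (hcon l)
      exact (abs_lt_of_sq_lt_sq this hr.le).le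
    refine (measure_mono hsub).trans ((measure_iUnion_fintype_le _ _).trans ?_)
    have hl l : P {ω | ENNReal.ofReal (r ^ 2) ≤ ENNReal.ofReal (A n ω l ^ 2)} ≤
        ENNReal.ofReal C / ENNReal.ofReal (r ^ 2) := by
      have hm : Measurable fun ω => ENNReal.ofReal (A n ω l ^ 2) := by
        have : Measurable fun ω => A n ω l := (measurable_pi_apply l).comp (hA n)
        fun_prop
      refine (meas_ge_le_lintegral_div hm.aemeasurable (by simpa using hr.ne') (by simp)).trans ?_
      gcongr
      exact h n l
    refine (Finset.sum_le_sum fun l _ => hl l).trans ?_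
    rw [Finset.sum_const, Finset.card_univ, nsmul_eq_mul, ← ENNReal.ofReal_div_of_pos hr2,
      ← ENNReal.ofReal_natCast, ← ENNReal.ofReal_mul (by positivity), mul_assoc, div_eq_mul_inv]
  refine tendsto_of_tendsto_of_tendsto_of_le_of_le' tendsto_const_nhds ?_
    (Eventually.of_forall fun _ => zero_le) hbound
  have h1 : Tendsto (fun r : ℝ => Fintype.card ι * C * (r ^ 2)⁻¹) atTop (𝓝 0) := by
    simpa using (tendsto_inv_atTop_zero.comp (tendsto_pow_atTop (two_ne_zero))).const_mul
      (Fintype.card ι * C)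
  simpa using ENNReal.tendsto_ofReal h1

variable [IsProbabilityMeasure P]

lemma sameLimitingDistribution_of_tendsto_sub [TopologicalSpace E] [MeasurableSpace E]
    [OpensMeasurableSpace E] {A B : ℕ → Ω → E} (hA : ∀ n, Measurable (A n))
    (hB : ∀ n, Measurable (B n))
    (h : ∀ f : E →ᵇ ℝ,
      Tendsto (fun n => (∫ ω, f (A n ω) ∂P) - ∫ ω, f (B n ω) ∂P) atTop (𝓝 0)) :
    SameLimitingDistribution A B P := by
  have key {A B : ℕ → Ω → E} (hA : ∀ n, Measurable (A n)) (hB : ∀ n, Measurable (B n))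
      (h : ∀ f : E →ᵇ ℝ,
        Tendsto (fun n => (∫ ω, f (A n ω) ∂P) - ∫ ω, f (B n ω) ∂P) atTop (𝓝 0))
      (ν : Measure E) [IsProbabilityMeasure ν]
      (hlim : TendstoInDistribution A atTop id (fun _ => P) ν) :
      TendstoInDistribution B atTop id (fun _ => P) ν := by
    refine ⟨fun n => (hB n).aemeasurable, hlim.aemeasurable_limit, ?_⟩
    have h1 := ProbabilityMeasure.tendsto_iff_forall_integral_tendsto.1 hlim.tendsto
    refine ProbabilityMeasure.tendsto_iff_forall_integral_tendsto.2 fun f => ?_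
    have h2 := (h1 f).sub (h f)
    rw [sub_zero] at h2
    refine h2.congr fun n => ?_
    simp only [ProbabilityMeasure.coe_mk]
    rw [integral_map (hA n).aemeasurable f.continuous.measurable.aestronglyMeasurable,
      integral_map (hB n).aemeasurable f.continuous.measurable.aestronglyMeasurable]
    ring
  refine ⟨h, fun ν _ => ⟨key hA hB h ν, key hB hA (fun f => ?_) ν⟩⟩
  simpa using (h f).neg

variable [NormedAddCommGroup E] [NormedSpace ℝ E] [MeasurableSpace E] [BorelSpace E]
  [SecondCountableTopology E] [CompleteSpace E]

/-- Along any ultrafilter finer than `atTop`, Prokhorov's theorem gives both sequences of laws a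
limit. The hypothesis makes the characteristic functions of the two limits equal, so the limits
coincide and the difference of the integrals of `f` tends to `0` along the ultrafilter. -/
lemma sameLimitingDistribution_of_charFunDual {A B : ℕ → Ω → E} (hA : ∀ n, Measurable (A n))
    (hB : ∀ n, Measurable (B n))
    (hAt : IsTightMeasureSet (Set.range fun n => P.map (A n)))
    (hBt : IsTightMeasureSet (Set.range fun n => P.map (B n)))
    (h : ∀ L : StrongDual ℝ E, Tendsto (fun n => (∫ ω, Complex.exp (L (A n ω) * Complex.I) ∂P) -
      ∫ ω, Complex.exp (L (B n ω) * Complex.I) ∂P) atTop (𝓝 0)) :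
    SameLimitingDistribution A B P := by
  refine sameLimitingDistribution_of_tendsto_sub hA hB fun f => ?_
  rw [tendsto_iff_ultrafilter]
  intro 𝒰 h𝒰
  have key {A : ℕ → Ω → E} (hA : ∀ n, Measurable (A n))
      (hAt : IsTightMeasureSet (Set.range fun n => P.map (A n))) :
      ∃ μ : ProbabilityMeasure E,
        (∀ f : E →ᵇ ℝ, Tendsto (fun n => ∫ ω, f (A n ω) ∂P) 𝒰 (𝓝 (∫ x, f x ∂μ))) ∧
        ∀ L : StrongDual ℝ E, Tendsto (fun n => ∫ ω, Complex.exp (L (A n ω) * Complex.I) ∂P) 𝒰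
          (𝓝 (charFunDual (μ : Measure E) L)) := by
    let a : ℕ → ProbabilityMeasure E := fun n =>
      ⟨P.map (A n), Measure.isProbabilityMeasure_map (hA n).aemeasurable⟩
    have hc : IsCompact (closure (Set.range a)) := by
      apply isCompact_closure_of_isTightMeasureSet
      convert hAt using 1
      ext m
      constructor
      · rintro ⟨_, ⟨n, rfl⟩, rfl⟩
        exact ⟨n, rfl⟩
      · rintro ⟨n, rfl⟩
        exact ⟨a n, ⟨n, rfl⟩, rfl⟩
    obtain ⟨μ, -, hμ⟩ := hc.ultrafilter_le_nhds (𝒰.map a) (by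
      rw [le_principal_iff]
      exact Filter.mem_of_superset (Filter.range_mem_map) subset_closure)
    have hμ' : Tendsto a 𝒰 (𝓝 μ) := hμ
    refine ⟨μ, fun f => ?_, fun L => ?_⟩
    · refine ((ProbabilityMeasure.tendsto_iff_forall_integral_tendsto.1 hμ') f).congr fun n => ?_
      exact integral_map (hA n).aemeasurable f.continuous.measurable.aestronglyMeasurable
    · let F : E →ᵇ ℂ := BoundedContinuousFunction.ofNormedAddCommGroup
        (fun x => Complex.exp (L x * Complex.I)) (by fun_prop) 1
        fun x => by rw [Complex.norm_exp_ofReal_mul_I]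
      refine ((ProbabilityMeasure.tendsto_iff_forall_integral_rclike_tendsto ℂ).1 hμ' F).congr
        fun n => ?_
      exact integral_map (hA n).aemeasurable F.continuous.measurable.aestronglyMeasurable
  obtain ⟨μ, hμ, hμc⟩ := key hA hAt
  obtain ⟨ν, hν, hνc⟩ := key hB hBt
  have heq : (μ : Measure E) = ν := by
    apply Measure.ext_of_charFunDual
    ext L
    exact sub_eq_zero.1 (tendsto_nhds_unique ((hμc L).sub (hνc L)) ((h L).mono_left h𝒰))
  have := (hμ f).sub (hν f)
  rwa [heq, sub_self] at this

end Limit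

/-! ### Comparison theorem for centered vector inputs with equal covariances -/

section General

variable {𝕜 Ω ι : Type*} [RCLike 𝕜] [MeasurableSpace Ω] {P : Measure Ω} {ρ : ℝ}

lemma IsCenteredFamily.precomp {κ κ' : Type*} {x : κ → Ω → ι → ℝ} (hx : IsCenteredFamily x ρ P)
    {e : κ' → κ} (he : Function.Injective e) : IsCenteredFamily (fun i => x (e i)) ρ P where
  nonneg := hx.nonneg
  measurable _ := hx.measurable _
  indep := hx.indep.precomp he
  memLp_three _ := hx.memLp_three _
  integral_eq_zero _ := hx.integral_eq_zero _
  integral_abs_cube_le _ := hx.integral_abs_cube_le _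

lemma IsCenteredFamily.mono {κ : Type*} {x : κ → Ω → ι → ℝ} (hx : IsCenteredFamily x ρ P)
    {ρ' : ℝ} (h : ρ ≤ ρ') : IsCenteredFamily x ρ' P where
  nonneg := hx.nonneg.trans h
  measurable := hx.measurable
  indep := hx.indep
  memLp_three := hx.memLp_three
  integral_eq_zero := hx.integral_eq_zero
  integral_abs_cube_le i l := (hx.integral_abs_cube_le i l).trans h

/-- The random vector with coordinates `bilin u (x · l) (y · l)`. -/
def bilinVec {n : ℕ} (u : Matrix.unitaryGroup (Fin n) 𝕜) (x y : ℕ → ι → ℝ) (l : ι) : ℝ :=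
  bilin u (fun i => x i l) (fun j => y j l)

lemma measurable_bilinVec {n : ℕ} {α : Type*} [MeasurableSpace α]
    {u : α → Matrix.unitaryGroup (Fin n) 𝕜} {x y : ℕ → α → ι → ℝ} (hu : Measurable u)
    (hx : ∀ i, Measurable (x i)) (hy : ∀ j, Measurable (y j)) :
    Measurable fun a => bilinVec (u a) (fun i => x i a) (fun j => y j a) := by
  refine measurable_pi_lambda _ fun l => ?_
  have hx' i : Measurable fun a => x i a l := (measurable_pi_apply l).comp (hx i)
  have hy' j : Measurable fun a => y j a l := (measurable_pi_apply l).comp (hy j)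
  have hu' i j : Measurable fun a => ‖(u a).1 i j‖ := (continuous_norm_entry i j).measurable.comp hu
  unfold bilinVec bilin
  fun_prop

/-- Every continuous linear functional is thus a phase with weights `L (Pi.single l 1)`, so the
fixed-matrix bound covers all characteristic functions. -/
lemma dual_apply_bilinVec [Fintype ι] [DecidableEq ι] {n : ℕ}
    (u : Matrix.unitaryGroup (Fin n) 𝕜) (L : StrongDual ℝ (ι → ℝ)) (x y : ℕ → ι → ℝ) :
    L (bilinVec u x y) = phase (fun i j => ‖u.1 i j‖ ^ 2) (fun l => L (Pi.single l 1))
      (fun i : Fin n => x i) (fun j : Fin n => y j) := by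
  have h : L (bilinVec u x y) = ∑ l, bilinVec u x y l * L (Pi.single l 1) := by
    conv_lhs => rw [pi_eq_sum_univ' (bilinVec u x y)]
    simp [map_sum]
  rw [h]
  simp only [bilinVec, bilin, phase, Finset.sum_mul, Finset.mul_sum]
  rw [Finset.sum_comm]
  exact Finset.sum_congr rfl fun i _ => Finset.sum_congr rfl fun l _ =>
    Finset.sum_congr rfl fun j _ => by ring

variable {U : (n : ℕ) → Ω → Matrix.unitaryGroup (Fin n) 𝕜}

lemma IndependentInputs.indepFun_fin {E : Type*} [MeasurableSpace E] {x y : ℕ → Ω → E}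
    (h : IndependentInputs U x y P) (n : ℕ) :
    IndepFun (fun ω (i : Fin n) => x i ω) (fun ω (j : Fin n) => y j ω) P :=
  h.indepFun_left_right.comp (φ := fun (v : ℕ → E) (i : Fin n) => v i)
    (ψ := fun (v : ℕ → E) (i : Fin n) => v i) (by fun_prop) (by fun_prop)

variable [IsProbabilityMeasure P]

lemma lintegral_sq_bilinVec_le (hU : ∀ n, IsHaarDistributed (U n) P) {x y : ℕ → Ω → ι → ℝ}
    (h : IndependentInputs U x y P) (hx : IsCenteredFamily x ρ P) (hy : IsCenteredFamily y ρ P)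
    (n : ℕ) (l : ι) :
    ∫⁻ ω, ENNReal.ofReal (bilinVec (U n ω) (fun i => x i ω) (fun j => y j ω) l ^ 2) ∂P ≤
      ENNReal.ofReal ((1 + ρ) ^ 2 * 3) := by
  have hm : Measurable fun p : ((ℕ → ι → ℝ) × (ℕ → ι → ℝ)) × Matrix.unitaryGroup (Fin n) 𝕜 =>
      ENNReal.ofReal (bilinVec p.2 p.1.1 p.1.2 l ^ 2) := by
    have := measurable_bilinVec (α := ((ℕ → ι → ℝ) × (ℕ → ι → ℝ)) × Matrix.unitaryGroup (Fin n) 𝕜)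
      (u := fun p => p.2) (x := fun i p => p.1.1 i) (y := fun i p => p.1.2 i) measurable_snd
      (fun i => (measurable_pi_apply i).comp (measurable_fst.comp measurable_fst))
      (fun i => (measurable_pi_apply i).comp (measurable_snd.comp measurable_fst))
    have := (measurable_pi_apply l).comp this
    exact (this.pow_const 2).ennreal_ofReal
  have hpair : Measurable fun ω => ((fun i => x i ω), (fun j => y j ω)) :=
    (measurable_pi_lambda _ hx.measurable).prodMk (measurable_pi_lambda _ hy.measurable)
  -- With the inputs in the first slot, the inner integral is over the inputs and the matrix is
  -- frozen.
  have e := lintegral_comp_of_indepFun (h.indepFun_matrix n).symm hpair (hU n).measurable hm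
  have := (hU n).isHaarMeasure
  have : IsProbabilityMeasure (P.map (U n)) :=
    Measure.isProbabilityMeasure_map (hU n).measurable.aemeasurable
  refine e.trans_le ?_
  have hinj : Function.Injective fun i : Fin n => (i : ℕ) := Fin.val_injective
  calc _ ≤ ∫⁻ ω', ENNReal.ofReal
        ((1 + ρ) ^ 2 * ∑ i, ∑ j, (‖(U n ω').1 i j‖ ^ 2) ^ 2) ∂P :=
        lintegral_mono fun ω' => (hx.precomp hinj).lintegral_sq_bilinear_le (hy.precomp hinj)
          (h.indepFun_fin n) (fun i j => ‖(U n ω').1 i j‖ ^ 2) l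
    _ = ∫⁻ u, ENNReal.ofReal ((1 + ρ) ^ 2 * ∑ i, ∑ j, (‖u.1 i j‖ ^ 2) ^ 2) ∂P.map (U n) := by
        have (i j : Fin n) := (continuous_norm_entry (𝕜 := 𝕜) i j).measurable
        rw [lintegral_map (by fun_prop) (hU n).measurable]
    _ = ENNReal.ofReal (∫ u, (1 + ρ) ^ 2 * ∑ i, ∑ j, (‖u.1 i j‖ ^ 2) ^ 2 ∂P.map (U n)) := by
        rw [ofReal_integral_eq_lintegral_ofReal]
        · exact (integrable_finsetSum _ fun i _ => integrable_finsetSum _ fun j _ =>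
            integrable_entry_pow i j 2).const_mul _
        · exact ae_of_all _ fun u => by positivity
    _ ≤ _ := by
        apply ENNReal.ofReal_le_ofReal
        rw [integral_const_mul, integral_finsetSum _ fun i _ => integrable_finsetSum _ fun j _ =>
            integrable_entry_pow i j 2]
        simp_rw [integral_finsetSum _ fun j _ => integrable_entry_pow _ j 2]
        exact mul_le_mul_of_nonneg_left sum_sum_integral_entry_fourth_le (by positivity)

variable [Fintype ι]

lemma integral_exp_dual_bilinVec (hU : ∀ n, IsHaarDistributed (U n) P) {x y : ℕ → Ω → ι → ℝ}
    (h : IndependentInputs U x y P) (n : ℕ) (L : StrongDual ℝ (ι → ℝ)) :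
    ∫ ω, Complex.exp (L (bilinVec (U n ω) (fun i => x i ω) (fun j => y j ω)) * Complex.I) ∂P =
      ∫ ω', ∫ ω, Complex.exp
        (L (bilinVec (U n ω') (fun i => x i ω) (fun j => y j ω)) * Complex.I) ∂P ∂P ∧
    Integrable (fun ω' => ∫ ω, Complex.exp
        (L (bilinVec (U n ω') (fun i => x i ω) (fun j => y j ω)) * Complex.I) ∂P) P := by
  have hm : Measurable fun p : ((ℕ → ι → ℝ) × (ℕ → ι → ℝ)) × Matrix.unitaryGroup (Fin n) 𝕜 =>
      L (bilinVec p.2 p.1.1 p.1.2) :=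
    L.continuous.measurable.comp <|
      measurable_bilinVec (α := ((ℕ → ι → ℝ) × (ℕ → ι → ℝ)) × Matrix.unitaryGroup (Fin n) 𝕜)
      (u := fun p => p.2) (x := fun i p => p.1.1 i) (y := fun i p => p.1.2 i) measurable_snd
      (fun i => (measurable_pi_apply i).comp (measurable_fst.comp measurable_fst))
      (fun i => (measurable_pi_apply i).comp (measurable_snd.comp measurable_fst))
  have hpair : Measurable fun ω => ((fun i => x i ω), (fun j => y j ω)) :=
    (measurable_pi_lambda _ h.measurable_left).prodMk (measurable_pi_lambda _ h.measurable_right)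
  refine ⟨integral_comp_of_indepFun (h.indepFun_matrix n).symm hpair (hU n).measurable hm, ?_⟩
  have hm2 := hm.comp ((hpair.comp measurable_fst).prodMk ((hU n).measurable.comp measurable_snd))
  exact (integrable_exp_mul_I (P := P.prod P) hm2.aestronglyMeasurable).integral_prod_right

lemma norm_integral_exp_bilinVec_sub_le (hU : ∀ n, IsHaarDistributed (U n) P)
    {x y x' y' : ℕ → Ω → ι → ℝ}
    (h : IndependentInputs U x y P) (h' : IndependentInputs U x' y' P)
    (hx : IsCenteredFamily x ρ P) (hy : IsCenteredFamily y ρ P)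
    (hx' : IsCenteredFamily x' ρ P) (hy' : IsCenteredFamily y' ρ P)
    (hcov : ∀ i l l', ∫ ω, x i ω l * x i ω l' ∂P = ∫ ω, x' i ω l * x' i ω l' ∂P)
    (hcov' : ∀ i l l', ∫ ω, y i ω l * y i ω l' ∂P = ∫ ω, y' i ω l * y' i ω l' ∂P)
    (L : StrongDual ℝ (ι → ℝ)) :
    ∃ C : ℝ, ∀ n : ℕ, 0 < n →
    ‖∫ ω, Complex.exp (L (bilinVec (U n ω) (fun i => x i ω) (fun j => y j ω)) * Complex.I) ∂P -
      ∫ ω, Complex.exp (L (bilinVec (U n ω) (fun i => x' i ω) (fun j => y' j ω)) * Complex.I) ∂P‖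
      ≤ C * (√n)⁻¹ := by
  classical
  have hρ := hx.nonneg
  -- `18 = 9 + 9`: the row and the column cube sums.
  refine ⟨replacementConst ρ (fun l => L (Pi.single l 1)) * 18, fun n hn => ?_⟩
  obtain ⟨e, hi⟩ := integral_exp_dual_bilinVec hU h n L
  obtain ⟨e', hi'⟩ := integral_exp_dual_bilinVec hU h' n L
  have := (hU n).isHaarMeasure
  have : IsProbabilityMeasure (P.map (U n)) :=
    Measure.isProbabilityMeasure_map (hU n).measurable.aemeasurable
  obtain ⟨hr, hr'⟩ := integral_rowCubeSum_le (μ := P.map (U n)) hn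
  obtain ⟨hc, hc'⟩ := integral_colCubeSum_le (μ := P.map (U n)) hn
  have hinj : Function.Injective fun i : Fin n => (i : ℕ) := Fin.val_injective
  rw [e, e', ← integral_sub hi hi']
  have hI := ((hr.fun_add hc).const_mul (replacementConst ρ fun l => L (Pi.single l 1)))
  refine (norm_integral_le_of_norm_le (hI.comp_measurable (hU n).measurable)
    (ae_of_all _ fun ω' => ?_)).trans ?_
  · simp only [dual_apply_bilinVec]
    exact (hx.precomp hinj).norm_integral_exp_phase_sub_le (hx'.precomp hinj) (hy.precomp hinj)
      (hy'.precomp hinj) (h.indepFun_fin n) (h'.indepFun_fin n) (fun i => hcov i)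
      (fun i => hcov' i) (fun i j => ‖(U n ω').1 i j‖ ^ 2) _
  · have e2 := integral_map (hU n).measurable.aemeasurable hI.1
    refine (e2.symm.le).trans ?_
    rw [integral_const_mul, integral_add hr hc, mul_assoc]
    refine mul_le_mul_of_nonneg_left (by linarith) ?_
    unfold replacementConst
    positivity

theorem sameLimitingDistribution_bilinVec (hU : ∀ n, IsHaarDistributed (U n) P)
    {x y x' y' : ℕ → Ω → ι → ℝ}
    (h : IndependentInputs U x y P) (h' : IndependentInputs U x' y' P)
    (hx : IsCenteredFamily x ρ P) (hy : IsCenteredFamily y ρ P)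
    (hx' : IsCenteredFamily x' ρ P) (hy' : IsCenteredFamily y' ρ P)
    (hcov : ∀ i l l', ∫ ω, x i ω l * x i ω l' ∂P = ∫ ω, x' i ω l * x' i ω l' ∂P)
    (hcov' : ∀ i l l', ∫ ω, y i ω l * y i ω l' ∂P = ∫ ω, y' i ω l * y' i ω l' ∂P) :
    SameLimitingDistribution
      (fun n ω => bilinVec (U n ω) (fun i => x i ω) (fun j => y j ω))
      (fun n ω => bilinVec (U n ω) (fun i => x' i ω) (fun j => y' j ω)) P := by
  have hA n := measurable_bilinVec (hU n).measurable hx.measurable hy.measurable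
  have hB n := measurable_bilinVec (hU n).measurable hx'.measurable hy'.measurable
  refine sameLimitingDistribution_of_charFunDual hA hB
    (isTightMeasureSet_of_lintegral_sq_le hA (lintegral_sq_bilinVec_le hU h hx hy))
    (isTightMeasureSet_of_lintegral_sq_le hB (lintegral_sq_bilinVec_le hU h' hx' hy')) fun L => ?_
  obtain ⟨C, hC⟩ := norm_integral_exp_bilinVec_sub_le hU h h' hx hy hx' hy' hcov hcov' L
  refine squeeze_zero_norm' (a := fun n : ℕ => C * (√n)⁻¹) ?_ ?_
  · filter_upwards [eventually_gt_atTop 0] with n hn using hC n hn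
  · simpa using ((tendsto_inv_atTop_zero.comp
      (Real.tendsto_sqrt_atTop.comp tendsto_natCast_atTop_atTop)).const_mul C)

end General

/-! ### Standardized scalar inputs -/

section Inputs

variable {𝕜 Ω : Type*} [RCLike 𝕜] [MeasurableSpace Ω] {P : Measure Ω}

lemma IndependentInputs.comp {E F : Type*} [MeasurableSpace E] [MeasurableSpace F]
    {U : (n : ℕ) → Ω → Matrix.unitaryGroup (Fin n) 𝕜} {x y : ℕ → Ω → E}
    (h : IndependentInputs U x y P) {φ ψ : E → F} (hφ : Measurable φ) (hψ : Measurable ψ) :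
    IndependentInputs U (fun i ω => φ (x i ω)) (fun j ω => ψ (y j ω)) P where
  measurable_left i := hφ.comp (h.measurable_left i)
  measurable_right j := hψ.comp (h.measurable_right j)
  iIndepFun_left := h.iIndepFun_left.comp (fun _ => φ) fun _ => hφ
  iIndepFun_right := h.iIndepFun_right.comp (fun _ => ψ) fun _ => hψ
  indepFun_left_right := h.indepFun_left_right.comp (φ := fun (v : ℕ → E) i => φ (v i))
    (ψ := fun (v : ℕ → E) i => ψ (v i)) (by fun_prop) (by fun_prop)
  indepFun_matrix n := (h.indepFun_matrix n).comp (φ := id)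
    (ψ := fun v : (ℕ → E) × (ℕ → E) => ((fun i => φ (v.1 i)), (fun j => ψ (v.2 j))))
    measurable_id (by fun_prop)

lemma IsStandardizedSeq.isCenteredFamily {x : ℕ → Ω → ℝ} (h : IsStandardizedSeq x P)
    (hm : ∀ i, Measurable (x i)) (hi : iIndepFun x P) :
    IsCenteredFamily (fun i ω (_ : Unit) => x i ω) (∫ ω, |x 0 ω| ^ 3 ∂P) P where
  nonneg := integral_nonneg fun ω => by positivity
  measurable i := measurable_pi_lambda _ fun _ => hm i
  indep := hi.comp (fun _ r _ => r) fun _ => by fun_prop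
  memLp_three i _ := h.memLp_three i
  integral_eq_zero i _ := h.integral_eq_zero i
  integral_abs_cube_le i _ :=
    ((h.identDistrib i).comp (u := fun r : ℝ => |r| ^ 3) (by fun_prop)).integral_eq.le

lemma IsStandardizedSeq.integral_mul_self {x : ℕ → Ω → ℝ} (h : IsStandardizedSeq x P)
    (hm : ∀ i, Measurable (x i)) (i : ℕ) : ∫ ω, x i ω * x i ω ∂P = 1 := by
  rw [← h.variance_eq_one i, variance_of_integral_eq_zero (hm i).aemeasurable
    (h.integral_eq_zero i)]
  simp only [sq]

lemma isStandardizedSeq_of_hasLaw_gaussianReal {x : ℕ → Ω → ℝ}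
    (h : ∀ i, HasLaw (x i) (gaussianReal 0 1) P) : IsStandardizedSeq x P where
  identDistrib i := ⟨(h i).aemeasurable, (h 0).aemeasurable, by rw [(h i).map_eq, (h 0).map_eq]⟩
  integral_eq_zero i := by rw [(h i).integral_eq, integral_id_gaussianReal]
  variance_eq_one i := by simp [(h i).variance_eq, variance_id_gaussianReal]
  memLp_three i := (h i).hasGaussianLaw.memLp (by norm_num)

end Inputs

/-! ### Centered indicators of uniform variables -/

section Uniform

variable {Ω : Type*} [MeasurableSpace Ω] {P : Measure Ω}

lemma abs_centeredIndicator_le_one (s : unitInterval) (r : ℝ) : |centeredIndicator s r| ≤ 1 := by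
  have h0 := s.2.1
  have h1 := s.2.2
  unfold centeredIndicator
  rw [abs_le]
  by_cases h : r ∈ Set.Iic (s : ℝ)
  · rw [Set.indicator_of_mem h]
    simp only [Pi.one_apply]
    constructor <;> linarith
  · rw [Set.indicator_of_notMem h]
    constructor <;> linarith

lemma measurable_centeredIndicator (s : unitInterval) : Measurable (centeredIndicator s) :=
  (measurable_one.indicator measurableSet_Iic).sub_const _

lemma integral_indicator_uniform {R : Ω → ℝ} (hm : Measurable R)
    (hR : pdf.IsUniform R (Set.Icc 0 1) P) (s : unitInterval) :
    ∫ ω, (Set.Iic (s : ℝ)).indicator (1 : ℝ → ℝ) (R ω) ∂P = s := by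
  have e : (fun ω => (Set.Iic (s : ℝ)).indicator (1 : ℝ → ℝ) (R ω)) =
      (R ⁻¹' Set.Iic (s : ℝ)).indicator 1 := by
    ext ω
    simp [Set.indicator]
  rw [e, integral_indicator_one (hm measurableSet_Iic), measureReal_def,
    hR.measure_preimage (by simp) (by simp) measurableSet_Iic]
  have : Set.Icc (0 : ℝ) 1 ∩ Set.Iic (s : ℝ) = Set.Icc 0 (s : ℝ) := by
    ext r
    have := s.2.2
    simp only [Set.mem_inter_iff, Set.mem_Icc, Set.mem_Iic]
    grind
  rw [this]
  simp [s.2.1]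

variable [IsProbabilityMeasure P]

lemma integrable_indicator_comp {R : Ω → ℝ} (hm : Measurable R) (s : unitInterval) :
    Integrable (fun ω => (Set.Iic (s : ℝ)).indicator (1 : ℝ → ℝ) (R ω)) P := by
  refine Integrable.of_bound (C := 1)
    ((measurable_one.indicator measurableSet_Iic).comp hm).aestronglyMeasurable
    (ae_of_all _ fun ω => ?_)
  exact (norm_indicator_le_norm_self _ _).trans (by simp)

lemma integral_centeredIndicator {R : Ω → ℝ} (hm : Measurable R)
    (hR : pdf.IsUniform R (Set.Icc 0 1) P) (s : unitInterval) :
    ∫ ω, centeredIndicator s (R ω) ∂P = 0 := by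
  unfold centeredIndicator
  rw [integral_sub (integrable_indicator_comp hm s) (integrable_const _),
    integral_indicator_uniform hm hR]
  simp

lemma integral_centeredIndicator_mul {R : Ω → ℝ} (hm : Measurable R)
    (hR : pdf.IsUniform R (Set.Icc 0 1) P) (s s' : unitInterval) :
    ∫ ω, centeredIndicator s (R ω) * centeredIndicator s' (R ω) ∂P =
      min (s : ℝ) (s' : ℝ) - (s : ℝ) * (s' : ℝ) := by
  -- The product of indicators is the indicator at `min s s'`. The last term is kept centered, so
  -- that its mean vanishes.
  have e r : centeredIndicator s r * centeredIndicator s' r =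
      (Set.Iic ((min s s' : unitInterval) : ℝ)).indicator (1 : ℝ → ℝ) r -
        (s : ℝ) * (Set.Iic (s' : ℝ)).indicator (1 : ℝ → ℝ) r - s' * centeredIndicator s r := by
    have : Set.Iic ((min s s' : unitInterval) : ℝ) = Set.Iic (s : ℝ) ∩ Set.Iic (s' : ℝ) := by
      rw [Set.Iic_inter_Iic]
      rfl
    rw [this, Set.inter_indicator_one]
    simp only [centeredIndicator, Pi.mul_apply]
    ring
  have hi := integrable_indicator_comp (P := P) hm
  have hc : Integrable (fun ω => centeredIndicator s (R ω)) P := (hi s).sub (integrable_const _)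
  simp_rw [e]
  have h1 : Integrable (fun ω => (Set.Iic ((min s s' : unitInterval) : ℝ)).indicator (1 : ℝ → ℝ)
      (R ω) - (s : ℝ) * (Set.Iic (s' : ℝ)).indicator (1 : ℝ → ℝ) (R ω)) P :=
    (hi _).sub ((hi s').const_mul _)
  rw [integral_sub h1 (hc.const_mul _), integral_sub (hi _) ((hi s').const_mul _),
    integral_const_mul, integral_const_mul, integral_indicator_uniform hm hR,
    integral_indicator_uniform hm hR, integral_centeredIndicator hm hR]
  simp

lemma isCenteredFamily_centeredIndicator {ι : Type*} {R : ℕ → Ω → ℝ} (hm : ∀ i, Measurable (R i))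
    (hi : iIndepFun R P) (hR : ∀ i, pdf.IsUniform (R i) (Set.Icc 0 1) P) (s : ι → unitInterval) :
    IsCenteredFamily (fun i ω l => centeredIndicator (s l) (R i ω)) 1 P where
  nonneg := zero_le_one
  measurable i := measurable_pi_lambda _ fun l => (measurable_centeredIndicator _).comp (hm i)
  indep := hi.comp (fun _ r l => centeredIndicator (s l) r)
    fun _ => measurable_pi_lambda _ fun l => measurable_centeredIndicator _
  memLp_three i l := MemLp.of_bound
    ((measurable_centeredIndicator _).comp (hm i)).aestronglyMeasurable 1
    (ae_of_all _ fun ω => abs_centeredIndicator_le_one _ _)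
  integral_eq_zero i l := integral_centeredIndicator (hm i) (hR i) _
  integral_abs_cube_le i l := by
    refine (integral_mono_of_nonneg (ae_of_all _ fun ω => by positivity) (integrable_const (1 : ℝ))
      (ae_of_all _ fun ω => ?_)).trans (by simp)
    exact pow_le_one₀ (abs_nonneg _) (abs_centeredIndicator_le_one _ _)

end Uniform

/-! ### Brownian bridges at finitely many times -/

section BrownianBridge

variable {Ω : Type*} [MeasurableSpace Ω] {P : Measure Ω}

lemma IsBrownianBridge.hasGaussianLaw_eval {b : Ω → unitInterval → ℝ} (h : IsBrownianBridge b P)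
    (s : unitInterval) : HasGaussianLaw (fun ω => b ω s) P := by
  obtain ⟨hg, -, -, -⟩ := h
  exact hg.hasGaussianLaw_eval s

lemma IsBrownianBridge.map_eval {b : Ω → unitInterval → ℝ} (h : IsBrownianBridge b P)
    (s : unitInterval) :
    P.map (fun ω => b ω s) = gaussianReal 0 ((s : ℝ) - s * s).toNNReal := by
  rw [(h.hasGaussianLaw_eval s).map_eq_gaussianReal,
    variance_of_integral_eq_zero (h.hasGaussianLaw_eval s).aemeasurable (h.centered s), h.centered s]
  have := h.covariance s s
  simp only [min_self] at this
  simp only [sq, this]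

/-- The law of `β i` at time `s l` is determined by its variance, so its third moment does not
depend on `i`; summing over `l` dominates each coordinate. -/
lemma isCenteredFamily_brownianBridge {ι : Type*} [Fintype ι] {β : ℕ → Ω → unitInterval → ℝ}
    (hm : ∀ i, Measurable (β i)) (hi : iIndepFun β P) (hβ : ∀ i, IsBrownianBridge (β i) P)
    (s : ι → unitInterval) :
    IsCenteredFamily (fun i ω l => β i ω (s l))
      (∑ l, ∫ r, |r| ^ 3 ∂gaussianReal 0 ((s l : ℝ) - s l * s l).toNNReal) P where
  nonneg := Finset.sum_nonneg fun l _ => integral_nonneg fun r => by positivity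
  measurable i := measurable_pi_lambda _ fun l => (measurable_pi_apply _).comp (hm i)
  indep := hi.comp (fun _ b l => b (s l)) fun _ => by fun_prop
  memLp_three i l := ((hβ i).hasGaussianLaw_eval (s l)).memLp (by norm_num)
  integral_eq_zero i l := (hβ i).centered (s l)
  integral_abs_cube_le i l := by
    have hmeas : Measurable fun ω => β i ω (s l) := (measurable_pi_apply _).comp (hm i)
    have hf : AEStronglyMeasurable (fun r : ℝ => |r| ^ 3) (P.map fun ω => β i ω (s l)) :=
      (by fun_prop : Continuous fun r : ℝ => |r| ^ 3).aestronglyMeasurable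
    rw [← integral_map hmeas.aemeasurable hf, (hβ i).map_eval]
    exact Finset.single_le_sum
      (f := fun l => ∫ r, |r| ^ 3 ∂gaussianReal 0 ((s l : ℝ) - s l * s l).toNNReal)
      (fun l _ => integral_nonneg fun r => by positivity) (Finset.mem_univ l)

end BrownianBridge

/-! ### The two statements -/

section Main

variable {𝕜 Ω : Type*} [RCLike 𝕜] [MeasurableSpace Ω] {P : Measure Ω} [IsProbabilityMeasure P]
  {U : (n : ℕ) → Ω → Matrix.unitaryGroup (Fin n) 𝕜}

theorem sameLimitingDistribution_bilin (hU : ∀ n, IsHaarDistributed (U n) P)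
    {R C X Y : ℕ → Ω → ℝ} (h : IndependentInputs U R C P) (hR : IsStandardizedSeq R P)
    (hC : IsStandardizedSeq C P) (h' : IndependentInputs U X Y P) (hX : IsStandardizedSeq X P)
    (hY : IsStandardizedSeq Y P) :
    SameLimitingDistribution
      (fun n ω => bilin (U n ω) (fun i => R i ω) (fun j => C j ω))
      (fun n ω => bilin (U n ω) (fun i => X i ω) (fun j => Y j ω)) P := by
  have fR := hR.isCenteredFamily h.measurable_left h.iIndepFun_left
  have fC := hC.isCenteredFamily h.measurable_right h.iIndepFun_right
  have fX := hX.isCenteredFamily h'.measurable_left h'.iIndepFun_left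
  have fY := hY.isCenteredFamily h'.measurable_right h'.iIndepFun_right
  have nR := fR.nonneg
  have nC := fC.nonneg
  have nX := fX.nonneg
  have nY := fY.nonneg
  have hconst : Measurable fun (r : ℝ) (_ : Unit) => r := by fun_prop
  -- Scalars are vectors indexed by `Unit`, and the sum of the four third moments serves as a common
  -- `ρ`.
  have key := sameLimitingDistribution_bilinVec hU (h.comp hconst hconst) (h'.comp hconst hconst)
    (ρ := (∫ ω, |R 0 ω| ^ 3 ∂P) + (∫ ω, |C 0 ω| ^ 3 ∂P) + (∫ ω, |X 0 ω| ^ 3 ∂P) +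
      ∫ ω, |Y 0 ω| ^ 3 ∂P)
    (fR.mono (by linarith)) (fC.mono (by linarith)) (fX.mono (by linarith)) (fY.mono (by linarith))
    (fun i _ _ => by
      rw [hR.integral_mul_self h.measurable_left, hX.integral_mul_self h'.measurable_left])
    (fun i _ _ => by
      rw [hC.integral_mul_self h.measurable_right, hY.integral_mul_self h'.measurable_right])
  have hmeas {x y : ℕ → Ω → ℝ} (h : IndependentInputs U x y P) (n : ℕ) :
      Measurable fun ω => bilin (U n ω) (fun i => x i ω) (fun j => y j ω) :=
    (measurable_pi_apply ()).comp (measurable_bilinVec (hU n).measurable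
      (h.comp hconst hconst).measurable_left (h.comp hconst hconst).measurable_right)
  refine sameLimitingDistribution_of_tendsto_sub (hmeas h) (hmeas h') fun f => ?_
  -- Evaluation at `()` transports the result from `Unit → ℝ` to `ℝ`.
  exact key.tendsto_sub (f.compContinuous ⟨fun v : Unit → ℝ => v (), continuous_apply ()⟩)

theorem sameLimitingDistribution_process (hU : ∀ n, IsHaarDistributed (U n) P)
    {R C : ℕ → Ω → ℝ} {β γ : ℕ → Ω → unitInterval → ℝ} (h : IndependentInputs U R C P)
    (hR : ∀ i, pdf.IsUniform (R i) (Set.Icc 0 1) P) (hC : ∀ j, pdf.IsUniform (C j) (Set.Icc 0 1) P)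
    (h' : IndependentInputs U β γ P) (hβ : ∀ i, IsBrownianBridge (β i) P)
    (hγ : ∀ j, IsBrownianBridge (γ j) P) {ι : Type*} [Fintype ι] (s t : ι → unitInterval) :
    SameLimitingDistribution
      (fun n ω (l : ι) => processZ (U n ω) (fun i => R i ω) (fun j => C j ω) (s l) (t l))
      (fun n ω (l : ι) => processG (U n ω) (fun i => β i ω) (fun j => γ j ω) (s l) (t l)) P := by
  have fR := isCenteredFamily_centeredIndicator h.measurable_left h.iIndepFun_left hR s
  have fC := isCenteredFamily_centeredIndicator h.measurable_right h.iIndepFun_right hC t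
  have fβ := isCenteredFamily_brownianBridge h'.measurable_left h'.iIndepFun_left hβ s
  have fγ := isCenteredFamily_brownianBridge h'.measurable_right h'.iIndepFun_right hγ t
  have nβ := fβ.nonneg
  have nγ := fγ.nonneg
  have hind (s : ι → unitInterval) : Measurable fun (r : ℝ) l => centeredIndicator (s l) r :=
    measurable_pi_lambda _ fun l => measurable_centeredIndicator _
  have heval (s : ι → unitInterval) : Measurable fun (b : unitInterval → ℝ) l => b (s l) := by
    fun_prop
  exact sameLimitingDistribution_bilinVec hU (h.comp (hind s) (hind t))
    (h'.comp (heval s) (heval t)) (fR.mono (le_add_of_nonneg_right (add_nonneg nβ nγ)))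
    (fC.mono (le_add_of_nonneg_right (add_nonneg nβ nγ))) (fβ.mono (by linarith))
    (fγ.mono (by linarith))
    (fun i l l' => by
      rw [integral_centeredIndicator_mul (h.measurable_left i) (hR i), (hβ i).covariance])
    (fun i l l' => by
      rw [integral_centeredIndicator_mul (h.measurable_right i) (hC i), (hγ i).covariance])

end Main

end RandomTruncation

end

theorem proposition4p2 {𝕜 Ω : Type*} [RCLike 𝕜] [MeasurableSpace Ω]
    (P : Measure Ω) [IsProbabilityMeasure P]
    (U : (n : ℕ) → Ω → Matrix.unitaryGroup (Fin n) 𝕜)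
    (hU : ∀ n, RandomTruncation.IsHaarDistributed (U n) P) :
    (∀ R C X Y : ℕ → Ω → ℝ,
      RandomTruncation.IndependentInputs U R C P →
      RandomTruncation.IsStandardizedSeq R P →
      RandomTruncation.IsStandardizedSeq C P →
      RandomTruncation.IndependentInputs U X Y P →
      (∀ i, HasLaw (X i) (gaussianReal 0 1) P) →
      (∀ j, HasLaw (Y j) (gaussianReal 0 1) P) →
      RandomTruncation.SameLimitingDistribution
        (fun n ω => RandomTruncation.bilin (U n ω) (fun i => R i ω) (fun j => C j ω))
        (fun n ω => RandomTruncation.bilin (U n ω) (fun i => X i ω) (fun j => Y j ω)) P) ∧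
    (∀ (R C : ℕ → Ω → ℝ) (β γ : ℕ → Ω → unitInterval → ℝ),
      RandomTruncation.IndependentInputs U R C P →
      (∀ i, pdf.IsUniform (R i) (Set.Icc 0 1) P) →
      (∀ j, pdf.IsUniform (C j) (Set.Icc 0 1) P) →
      RandomTruncation.IndependentInputs U β γ P →
      (∀ i, RandomTruncation.IsBrownianBridge (β i) P) →
      (∀ j, RandomTruncation.IsBrownianBridge (γ j) P) →
      ∀ (K : ℕ) (s t : Fin K → unitInterval),
        RandomTruncation.SameLimitingDistribution
          (fun n ω (l : Fin K) => RandomTruncation.processZ (U n ω)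
            (fun i => R i ω) (fun j => C j ω) (s l) (t l))
          (fun n ω (l : Fin K) => RandomTruncation.processG (U n ω)
            (fun i => β i ω) (fun j => γ j ω) (s l) (t l)) P) := by
  exact ⟨fun _ _ _ _ h hR hC h' hX hY =>
    RandomTruncation.sameLimitingDistribution_bilin hU h hR hC h'
      (RandomTruncation.isStandardizedSeq_of_hasLaw_gaussianReal hX)
      (RandomTruncation.isStandardizedSeq_of_hasLaw_gaussianReal hY),
    fun _ _ _ _ h hR hC h' hβ hγ _ s t =>
      RandomTruncation.sameLimitingDistribution_process hU h hR hC h' hβ hγ s t⟩
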